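/- Let $N\ge 1$ be an integer, $B\in\mathbb R$, $q\in L^2(0,1)$ real-valued, $s=e^{2\pi i/N}$, $\mathbb Z_m=\mathbb Z/m\mathbb Z$. **The tube.** The zigzag tube $\Gamma^{(N)}$ has edges $\Gamma_\omega=\{r^0_\omega+te_\omega:\ t\in[0,1]\}\subset\mathbb R^3$, $e_\omega=r_\omega^1-r_\omega^0$, $\omega=(n,j,k)\in\mathbb Z\times\mathbb Z_3\times\mathbb Z_N$, where $$r^0_{n,0,k}=(R\cos\theta_{n,k},R\sin\theta_{n,k},\tfrac{3n}2),\quad r^1_{n,0,k}=r^0_{n,0,k}+(0,0,1),\quad \theta_{n,k}=\frac{(2k+n)\pi}{N},\quad R=\frac{\sqrt3}{4\sin\frac{\pi}{2N}},$$ $$r^0_{n,1,k}=r^1_{n,0,k},\quad r^1_{n,1,k}=r^0_{n,2,k}=r^0_{n+1,0,k},\quad r^1_{n,2,k}=r^1_{n,0,k+1};$$ all edges have length one. For $N=1$ the edges $\Gamma_{n,1}$ and $\Gamma_{n,2}$ occupy the same segment but are regarded as different edges. Functions on the graph are families $f=(f_\omega)$ of functions on $[0,1]$, and $L^2(\Gamma^{(N)})=\bigoplus_\omega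 L^2(0,1)$. **The operator $\mathscr H$.** Let $\mathscr A(x)=\frac B2(-x_2,x_1,0)$, $a_\omega(t)=(\mathscr A(r_\omega^0+te_\omega),e_\omega)$ and $\partial_\omega=\frac{d}{dt}-ia_\omega$. The operator $\mathscr H$ in $L^2(\Gamma^{(N)})$ acts by $(\mathscr Hf)_\omega=-\partial_\omega^2f_\omega+qf_\omega$ on all $f\in L^2(\Gamma^{(N)})$ such that $f_\omega$ and $\partial_\omega f_\omega$ are absolutely continuous on $[0,1]$, $(\partial_\omega^2f_\omega)_\omega\in L^2(\Gamma^{(N)})$, and, for all $(n,k)\in\mathbb Z\times\mathbb Z_N$ and with $\omega=(n,1,k)$, $\omega_1=(n+1,0,k)$, $\omega_2=(n,2,k)$, $\omega_3=(n,0,k)$, $\omega_4=(n,2,k-1)$, $$f_{\omega_3}(1)=f_\omega(0)=f_{\omega_4}(1),\qquad f_{\omega_1}(0)=f_\omega(1)=f_{\omega_2}(0),$$ $$-\partial_{\omega_3}f_{\omega_3}(1)+\partial_\omega f_\omega(0)-\partial_{\omega_4}f_{\omega_4}(1)=0,\qquad \partial_{\omega_1}f_{\omega_1}(0)-\partial_\omega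 f_\omega(1)+\partial_{\omega_2}f_{\omega_2}(0)=0.$$ **The operators $H_k(a)$.** For $a\in\mathbb R$ and $k\in\mathbb Z$, the operator $H_k(a)$ in $L^2(\Gamma^{(1)})$, whose edges are indexed by $(n,j)\in\mathbb Z\times\mathbb Z_3$, acts by $(H_kf)_{n,j}=-f_{n,j}''+qf_{n,j}$ on all $f\in L^2(\Gamma^{(1)})$ such that $f_{n,j},f'_{n,j}$ are absolutely continuous on $[0,1]$, $f''\in L^2(\Gamma^{(1)})$, and, for all $n\in\mathbb Z$, $$(K)\qquad\begin{aligned}&f_{n,0}(1)=f_{n,1}(0)=e^{ia}s^kf_{n,2}(1),\qquad f_{n+1,0}(0)=e^{ia}f_{n,1}(1)=f_{n,2}(0),\\ &-f'_{n,0}(1)+f'_{n,1}(0)-e^{ia}s^kf'_{n,2}(1)=0,\qquad f'_{n+1,0}(0)-e^{ia}f'_{n,1}(1)+f'_{n,2}(0)=0.\end{aligned}$$ **Scalar data.** Let $\vartheta(t,\lambda),\varphi(t,\lambda)$ be the solutions of $-y''+qy=\lambda y$ on $[0,1]$ with $\vartheta(0,\lambda)=\varphi'(0,\lambda)=1$,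 $\vartheta'(0,\lambda)=\varphi(0,\lambda)=0$. Let $\sigma_D$ be the Dirichlet spectrum, that is, the set of $\lambda\in\mathbb C$ for which $-y''+qy=\lambda y$, $y(0)=y(1)=0$ has a nonzero solution. Put $$\mathcal M=\begin{pmatrix}\vartheta(1,\cdot)&\varphi(1,\cdot)\\ \vartheta'(1,\cdot)&\varphi'(1,\cdot)\end{pmatrix},\quad \Delta=\frac{\varphi'(1,\cdot)+\vartheta(1,\cdot)}2,\quad F=2\Delta^2+\frac{\varphi(1,\cdot)\vartheta'(1,\cdot)}4-1,$$ $c_k=\cos(a+\frac{\pi k}N)$, $s_k=\sin(a+\frac{\pi k}N)$, $s^{-k/2}=e^{-i\pi k/N}$. **Theorem 1.1.** (i) One has $a_{n,0,k}(t)=0$ and $a_{n,1,k}(t)=a_{n,2,k}(t)=a$ for all $n,k,t$, where $a=\frac{3B}{16}\cot\frac{\pi}{2N}$, and with this $a$ the operator $\mathscr H$ is unitarily equivalent to $\bigoplus_{k=1}^NH_k(a)$. (ii) Let $a\in\mathbb R$ and $k\in\mathbb Z$ with $c_k\ne0$. For every $\lambda\in\mathbb C\setminus\sigma_D$ there are unique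 functions $\Theta_k(\cdot,\lambda),\Phi_k(\cdot,\lambda)$ on $\Gamma^{(1)}$ that satisfy $-f_{n,j}''+qf_{n,j}=\lambda f_{n,j}$ on every edge, the conditions $(K)$, and, on the edge $(0,0)$, $$\Theta_{k,(0,0)}(0,\lambda)=\Phi_{k,(0,0)}'(0,\lambda)=1,\qquad \Theta_{k,(0,0)}'(0,\lambda)=\Phi_{k,(0,0)}(0,\lambda)=0.$$ At every point of $\Gamma^{(1)}$ the functions $\Theta_k,\Phi_k$ are meromorphic in $\lambda\in\mathbb C$ and analytic in $\lambda\in\mathbb C\setminus\sigma_D$. For $\lambda\in\mathbb C\setminus\sigma_D$ the matrix $$\mathcal M_k(\lambda)=\begin{pmatrix}\Theta_{k,(1,0)}(0,\lambda)&\Phi_{k,(1,0)}(0,\lambda)\\ \Theta'_{k,(1,0)}(0,\lambda)&\Phi'_{k,(1,0)}(0,\lambda)\end{pmatrix}$$ satisfies $$\mathcal M_k=\mathcal R^{-1}\mathcal T_k\mathcal R\mathcal M,\quad \mathcal T_k=\frac{s^{-k/2}}{2c_k}\begin{pmatrix}2\Delta&1\\4\Delta^2-4c_k^2&2\Delta\end{pmatrix},\quad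 \mathcal R=\begin{pmatrix}1&0\\0&\varphi(1,\cdot)\end{pmatrix},$$ $$\det\mathcal M_k=s^{-k},\qquad \operatorname{Tr}\mathcal M_k=\frac{2s^{-k/2}(F+s_k^2)}{c_k},$$ and $D_k(\tau,\lambda)=\det(\mathcal M_k(\lambda)-\tau I_2)$ extends from $\lambda\in\mathbb C\setminus\sigma_D$ to an entire function of $(\tau,\lambda)\in\mathbb C^2$. -/

import Mathlib

open MeasureTheory Complex

noncomputable section

namespace ZigzagTube

/-! ### Differential expressions on the unit interval -/

/-- Lebesgue measure on the unit interval `[0,1]`, the model of every edge. -/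
abbrev unitMeasure : Measure ℝ := volume.restrict (Set.Icc (0 : ℝ) 1)

/-- `f` is absolutely continuous on `[0,1]` with almost everywhere derivative `g ∈ L¹(0,1)`. -/
def HasACDeriv (f g : ℝ → ℂ) : Prop :=
  IntervalIntegrable g volume 0 1 ∧
    ∀ t ∈ Set.Icc (0 : ℝ) 1, f t = f 0 + ∫ x in (0 : ℝ)..t, g x

/-- `f` is absolutely continuous on `[0,1]` and its magnetic derivative `∂f = f' - iαf` with
respect to the potential `α` is `g`, that is, `f' = g + iαf` almost everywhere. -/
def HasMagDeriv (α : ℝ → ℝ) (f g : ℝ → ℂ) : Prop :=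
  HasACDeriv f (fun x => g x + I * (α x : ℂ) * f x)

/-- `y` solves `-y'' + q y = lam y` on `[0,1]` in the Carathéodory sense: `y` and `y' = dy` are
absolutely continuous and the equation holds almost everywhere. -/
def IsODESolution (q : ℝ → ℝ) (lam : ℂ) (y dy : ℝ → ℂ) : Prop :=
  HasACDeriv y dy ∧ HasACDeriv dy (fun t => ((q t : ℂ) - lam) * y t)

/-- The solution of `-y'' + q y = lam y` on `[0,1]` with `y(0) = c₀`, `y'(0) = c₁`, as the pair
`(y, y')` (only the values on `[0,1]` are meaningful). -/
def ivpSolution (q : ℝ → ℝ) (lam c₀ c₁ : ℂ) : (ℝ → ℂ) × (ℝ → ℂ) :=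
  Classical.epsilon fun p => IsODESolution q lam p.1 p.2 ∧ p.1 0 = c₀ ∧ p.2 0 = c₁

/-- The fundamental solution `ϑ(t, lam)`, with `ϑ(0) = 1`, `ϑ'(0) = 0`. -/
def vartheta (q : ℝ → ℝ) (t : ℝ) (lam : ℂ) : ℂ := (ivpSolution q lam 1 0).1 t

/-- The derivative `ϑ'(t, lam)`. -/
def vartheta' (q : ℝ → ℝ) (t : ℝ) (lam : ℂ) : ℂ := (ivpSolution q lam 1 0).2 t

/-- The fundamental solution `φ(t, lam)`, with `φ(0) = 0`, `φ'(0) = 1`. -/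
def varphi (q : ℝ → ℝ) (t : ℝ) (lam : ℂ) : ℂ := (ivpSolution q lam 0 1).1 t

/-- The derivative `φ'(t, lam)`. -/
def varphi' (q : ℝ → ℝ) (t : ℝ) (lam : ℂ) : ℂ := (ivpSolution q lam 0 1).2 t

/-- The monodromy matrix of the scalar equation on `[0,1]`. -/
def scalarMonodromy (q : ℝ → ℝ) (lam : ℂ) : Matrix (Fin 2) (Fin 2) ℂ :=
  !![vartheta q 1 lam, varphi q 1 lam; vartheta' q 1 lam, varphi' q 1 lam]

/-- The Lyapunov function `Δ = (φ'(1,·) + ϑ(1,·)) / 2`. -/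
def lyapunov (q : ℝ → ℝ) (lam : ℂ) : ℂ := (varphi' q 1 lam + vartheta q 1 lam) / 2

/-- `F = 2Δ² + φ(1,·)ϑ'(1,·)/4 - 1`. -/
def lyapunovF (q : ℝ → ℝ) (lam : ℂ) : ℂ :=
  2 * lyapunov q lam ^ 2 + varphi q 1 lam * vartheta' q 1 lam / 4 - 1

/-- The Dirichlet spectrum `σ_D` of `-y'' + q y` on `[0,1]`. -/
def dirichletSpectrum (q : ℝ → ℝ) : Set ℂ :=
  {lam | ∃ y dy : ℝ → ℂ, IsODESolution q lam y dy ∧ y 0 = 0 ∧ y 1 = 0 ∧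
    ∃ t ∈ Set.Icc (0 : ℝ) 1, y t ≠ 0}

/-! ### Schrödinger operators on a metric graph whose edges are copies of `[0,1]` -/

/-- The Hilbert space `⨁_ω L²(Γ_ω)` of a graph with edges `Γ_ω ≅ [0,1]`, `ω ∈ ι`. -/
abbrev GraphL2 (ι : Type) : Type := lp (fun _ : ι => Lp ℂ 2 unitMeasure) 2

/-- Boundary data of a function on the graph: its values and its (magnetic) derivatives
at the initial point (`0`) and the final point (`1`) of every edge. -/
abbrev BoundaryData (ι : Type) : Type := (ι → Fin 2 → ℂ) × (ι → Fin 2 → ℂ)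

/-- The values at the two endpoints of every edge. -/
def endpoints {ι : Type} (f : ι → ℝ → ℂ) : ι → Fin 2 → ℂ := fun ω => ![f ω 0, f ω 1]

lemma endpoints_add {ι : Type} (f g : ι → ℝ → ℂ) :
    endpoints (fun ω t => f ω t + g ω t) = endpoints f + endpoints g := by
  funext ω i
  fin_cases i <;> simp [endpoints]

lemma endpoints_smul {ι : Type} (c : ℂ) (f : ι → ℝ → ℂ) :
    endpoints (fun ω t => c * f ω t) = c • endpoints f := by
  funext ω i
  fin_cases i <;> simp [endpoints]

lemma HasACDeriv.add {f₁ f₂ g₁ g₂ : ℝ → ℂ} (h₁ : HasACDeriv f₁ g₁) (h₂ : HasACDeriv f₂ g₂) :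
    HasACDeriv (fun t => f₁ t + f₂ t) (fun t => g₁ t + g₂ t) := by
  refine ⟨h₁.1.add h₂.1, fun t ht => ?_⟩
  have hs : Set.uIcc (0 : ℝ) t ⊆ Set.uIcc 0 1 :=
    Set.uIcc_subset_uIcc_left (by simpa using ht)
  beta_reduce
  rw [intervalIntegral.integral_add (h₁.1.mono_set hs) (h₂.1.mono_set hs), h₁.2 t ht, h₂.2 t ht]
  ring

lemma HasACDeriv.smul {f g : ℝ → ℂ} (c : ℂ) (h : HasACDeriv f g) :
    HasACDeriv (fun t => c * f t) (fun t => c * g t) := by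
  refine ⟨h.1.const_mul c, fun t ht => ?_⟩
  beta_reduce
  rw [intervalIntegral.integral_const_mul, h.2 t ht]
  ring

lemma HasMagDeriv.add {α : ℝ → ℝ} {f₁ f₂ g₁ g₂ : ℝ → ℂ} (h₁ : HasMagDeriv α f₁ g₁)
    (h₂ : HasMagDeriv α f₂ g₂) :
    HasMagDeriv α (fun t => f₁ t + f₂ t) (fun t => g₁ t + g₂ t) := by
  have h := HasACDeriv.add h₁ h₂
  unfold HasMagDeriv
  convert h using 2
  ring

lemma HasMagDeriv.smul {α : ℝ → ℝ} {f g : ℝ → ℂ} (c : ℂ) (h : HasMagDeriv α f g) :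
    HasMagDeriv α (fun t => c * f t) (fun t => c * g t) := by
  have h := HasACDeriv.smul c h
  unfold HasMagDeriv
  convert h using 2
  ring

lemma HasACDeriv.continuousOn {f g : ℝ → ℂ} (h : HasACDeriv f g) :
    ContinuousOn f (Set.Icc 0 1) := by
  have h1 : ContinuousOn (fun t => f 0 + ∫ x in (0 : ℝ)..t, g x) (Set.Icc 0 1) := by
    refine continuousOn_const.add ?_
    have := intervalIntegral.continuousOn_primitive_interval' h.1
      (a := 0) (by simp)
    simpa using this
  exact h1.congr h.2

lemma HasMagDeriv.ae_eq_zero {α : ℝ → ℝ} {f g : ℝ → ℂ} (h : HasMagDeriv α f g)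
    (hf : f =ᵐ[unitMeasure] 0) : g =ᵐ[unitMeasure] 0 := by
  have hf0 : Set.EqOn f 0 (Set.Icc 0 1) :=
    Measure.eqOn_Icc_of_ae_eq volume (by norm_num) hf (HasACDeriv.continuousOn h)
      continuousOn_const
  have hd := h.1.ae_hasDerivAt_integral
  have hne : ∀ᵐ x : ℝ, x ≠ 0 ∧ x ≠ 1 := by
    have a0 : ∀ᵐ x : ℝ, x ≠ 0 := by simp [ae_iff]
    have a1 : ∀ᵐ x : ℝ, x ≠ 1 := by simp [ae_iff]
    exact a0.and a1
  refine (ae_restrict_iff' measurableSet_Icc).2 ?_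
  filter_upwards [hd, hne] with x hx hx01 hxI
  have hd' := hx (by simpa using hxI) 0 (by simp)
  have hnhds : Set.Icc (0 : ℝ) 1 ∈ nhds x :=
    Icc_mem_nhds (lt_of_le_of_ne hxI.1 (Ne.symm hx01.1)) (lt_of_le_of_ne hxI.2 hx01.2)
  have hz : (fun t => ∫ y in (0 : ℝ)..t, (g y + I * (α y : ℂ) * f y)) =ᶠ[nhds x]
      fun _ => (0 : ℂ) := by
    filter_upwards [hnhds] with t ht
    have h2 := h.2 t ht
    rw [hf0 ht, hf0 (by simp : (0 : ℝ) ∈ Set.Icc (0 : ℝ) 1)] at h2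
    simpa using h2.symm
  have := (hd'.congr_of_eventuallyEq hz.symm).unique (hasDerivAt_const x (0 : ℂ))
  simpa [hf0 hxI] using this

/-- The graph of the operator `f ↦ -∂_ω² f_ω + q f_ω`, `∂_ω = d/dt - iα_ω`, whose domain consists
of the `f ∈ L²(Γ)` with `f_ω` and `∂_ω f_ω` absolutely continuous, `∂²f ∈ L²(Γ)`, that satisfy the
vertex conditions `BC` on the values of `f` and `∂f` at the ends of the edges. -/
def schrodingerGraph {ι : Type} (α : ι → ℝ → ℝ) (q : ℝ → ℝ)
    (BC : Submodule ℂ (BoundaryData ι)) : Submodule ℂ (GraphL2 ι × GraphL2 ι) where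
  carrier := {p | ∃ f f₁ f₂ : ι → ℝ → ℂ,
    (∀ ω, p.1 ω =ᵐ[unitMeasure] f ω) ∧
    (∀ ω, HasMagDeriv (α ω) (f ω) (f₁ ω)) ∧
    (∀ ω, HasMagDeriv (α ω) (f₁ ω) (f₂ ω)) ∧
    (∃ G : GraphL2 ι, ∀ ω, G ω =ᵐ[unitMeasure] f₂ ω) ∧
    (endpoints f, endpoints f₁) ∈ BC ∧
    ∀ ω, p.2 ω =ᵐ[unitMeasure] fun t => -f₂ ω t + (q t : ℂ) * f ω t}
  add_mem' := by
    rintro p p' ⟨f, f₁, f₂, a, b, c, ⟨G, d⟩, e, g⟩ ⟨f', f₁', f₂', a', b', c', ⟨G', d'⟩, e', g'⟩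
    refine ⟨fun ω t => f ω t + f' ω t, fun ω t => f₁ ω t + f₁' ω t, fun ω t => f₂ ω t + f₂' ω t,
      fun ω => ?_, fun ω => (b ω).add (b' ω), fun ω => (c ω).add (c' ω),
      ⟨G + G', fun ω => ?_⟩, ?_, fun ω => ?_⟩
    · filter_upwards [Lp.coeFn_add (p.1 ω) (p'.1 ω), a ω, a' ω] with t h1 h2 h3
      simpa [h2, h3] using h1
    · filter_upwards [Lp.coeFn_add (G ω) (G' ω), d ω, d' ω] with t h1 h2 h3
      simpa [h2, h3] using h1
    · rw [endpoints_add, endpoints_add]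
      exact BC.add_mem e e'
    · filter_upwards [Lp.coeFn_add (p.2 ω) (p'.2 ω), g ω, g' ω] with t h1 h2 h3
      simp only [Pi.add_apply, h2, h3] at h1
      simp only [Prod.snd_add, lp.coeFn_add, Pi.add_apply, h1]
      ring
  zero_mem' := by
    refine ⟨fun _ _ => 0, fun _ _ => 0, fun _ _ => 0, fun ω => ?_, fun ω => ?_, fun ω => ?_,
      ⟨0, fun ω => ?_⟩, ?_, fun ω => ?_⟩
    · filter_upwards [Lp.coeFn_zero ℂ 2 unitMeasure] with t h1
      simpa using h1
    · simp [HasMagDeriv, HasACDeriv]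
    · simp [HasMagDeriv, HasACDeriv]
    · filter_upwards [Lp.coeFn_zero ℂ 2 unitMeasure] with t h1
      simpa using h1
    · convert BC.zero_mem using 1
      ext ω i <;> fin_cases i <;> simp [endpoints]
    · filter_upwards [Lp.coeFn_zero ℂ 2 unitMeasure] with t h1
      simpa using h1
  smul_mem' := by
    rintro z p ⟨f, f₁, f₂, a, b, c, ⟨G, d⟩, e, g⟩
    refine ⟨fun ω t => z * f ω t, fun ω t => z * f₁ ω t, fun ω t => z * f₂ ω t,
      fun ω => ?_, fun ω => (b ω).smul z, fun ω => (c ω).smul z,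
      ⟨z • G, fun ω => ?_⟩, ?_, fun ω => ?_⟩
    · filter_upwards [Lp.coeFn_smul z (p.1 ω), a ω] with t h1 h2
      simpa [h2] using h1
    · filter_upwards [Lp.coeFn_smul z (G ω), d ω] with t h1 h2
      simpa [h2] using h1
    · rw [endpoints_smul, endpoints_smul]
      exact BC.smul_mem z e
    · filter_upwards [Lp.coeFn_smul z (p.2 ω), g ω] with t h1 h2
      simp only [Pi.smul_apply, h2, smul_eq_mul] at h1
      simp only [Prod.smul_snd, lp.coeFn_smul, Pi.smul_apply, h1]
      ring

/-- The set `schrodingerGraph α q BC` is the graph of a function. -/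
lemma schrodingerGraph_functional {ι : Type} (α : ι → ℝ → ℝ) (q : ℝ → ℝ)
    (BC : Submodule ℂ (BoundaryData ι)) (p : GraphL2 ι × GraphL2 ι)
    (hp : p ∈ schrodingerGraph α q BC) (h0 : p.1 = 0) : p.2 = 0 := by
  obtain ⟨f, f₁, f₂, a, b, c, -, -, g⟩ := hp
  ext ω : 2
  have hf : f ω =ᵐ[unitMeasure] 0 := by
    filter_upwards [a ω, Lp.coeFn_zero ℂ 2 unitMeasure] with t h1 h2
    rw [← h1, h0]
    simpa using h2
  have hf2 := (c ω).ae_eq_zero ((b ω).ae_eq_zero hf)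
  refine Lp.ext ?_
  filter_upwards [g ω, hf, hf2, Lp.coeFn_zero ℂ 2 unitMeasure] with t h1 h2 h3 h4
  rw [h1, h2, h3]
  simpa using h4.symm

/-- The Schrödinger operator `f ↦ -∂_ω² f_ω + q f_ω` on the graph, as an unbounded operator in
`L²(Γ)` with the domain described at `schrodingerGraph`. -/
def schrodingerOp {ι : Type} (α : ι → ℝ → ℝ) (q : ℝ → ℝ) (BC : Submodule ℂ (BoundaryData ι)) :
    GraphL2 ι →ₗ.[ℂ] GraphL2 ι :=
  (schrodingerGraph α q BC).toLinearPMap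

lemma schrodingerOp_graph {ι : Type} (α : ι → ℝ → ℝ) (q : ℝ → ℝ)
    (BC : Submodule ℂ (BoundaryData ι)) :
    (schrodingerOp α q BC).graph = schrodingerGraph α q BC :=
  Submodule.toLinearPMap_graph_eq _ (schrodingerGraph_functional α q BC)

/-! ### Unbounded operators: orthogonal sums and unitary equivalence -/

/-- The orthogonal sum of finitely many unbounded operators in a Hilbert space `E`. -/
def orthogonalSum {κ E : Type} [Fintype κ] [NormedAddCommGroup E] [InnerProductSpace ℂ E]
    (T : κ → E →ₗ.[ℂ] E) : PiLp 2 (fun _ : κ => E) →ₗ.[ℂ] PiLp 2 (fun _ : κ => E) where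
  domain :=
    { carrier := {x | ∀ k, x k ∈ (T k).domain}
      add_mem' := fun hx hy k => (T k).domain.add_mem (hx k) (hy k)
      zero_mem' := fun k => (T k).domain.zero_mem
      smul_mem' := fun c _ hx k => (T k).domain.smul_mem c (hx k) }
  toFun :=
    { toFun := fun x => WithLp.toLp 2 fun k => T k ⟨x.1 k, x.2 k⟩
      map_add' := fun x y => by
        ext k
        exact (T k).map_add ⟨x.1 k, x.2 k⟩ ⟨y.1 k, y.2 k⟩
      map_smul' := fun c x => by
        ext k
        exact (T k).map_smul c ⟨x.1 k, x.2 k⟩ }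

/-- Unitary equivalence of unbounded operators: a unitary map takes the domain of `S` onto the
domain of `T` and intertwines the two operators. -/
def UnitarilyEquivalent {E F : Type} [NormedAddCommGroup E] [InnerProductSpace ℂ E]
    [NormedAddCommGroup F] [InnerProductSpace ℂ F] (S : E →ₗ.[ℂ] E) (T : F →ₗ.[ℂ] F) : Prop :=
  ∃ U : E ≃ₗᵢ[ℂ] F, (∀ x, x ∈ S.domain ↔ U x ∈ T.domain) ∧
    ∀ (x : S.domain) (y : T.domain), U x = y → U (S x) = T y

/-! ### The zigzag tube `Γ^(N)` in a uniform magnetic field along its axis -/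

/-- The index set `ℤ × ℤ₃ × ℤ_N` of the edges of `Γ^(N)`. -/
abbrev Edge (N : ℕ) : Type := ℤ × ZMod 3 × ZMod N

/-- The radius of the tube, for which all edges have length one. -/
def tubeRadius (N : ℕ) : ℝ := √3 / (4 * Real.sin (Real.pi / (2 * N)))

/-- The point of the tube of radius `tubeRadius N` with polar angle `θ` and height `h`. -/
def tubePoint (N : ℕ) (θ h : ℝ) : EuclideanSpace ℝ (Fin 3) :=
  !₂[tubeRadius N * Real.cos θ, tubeRadius N * Real.sin θ, h]

/-- The polar angle of the vertical edge `Γ_{n,0,k}`. -/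
def edgeAngle (N : ℕ) (n : ℤ) (k : ZMod N) : ℝ := (2 * (k.val : ℝ) + n) * (Real.pi / N)

/-- The lower end of the vertical edge `Γ_{n,0,k}`. -/
def lowerVertex (N : ℕ) (n : ℤ) (k : ZMod N) : EuclideanSpace ℝ (Fin 3) :=
  tubePoint N (edgeAngle N n k) (3 / 2 * n)

/-- The upper end of the vertical edge `Γ_{n,0,k}`. -/
def upperVertex (N : ℕ) (n : ℤ) (k : ZMod N) : EuclideanSpace ℝ (Fin 3) :=
  tubePoint N (edgeAngle N n k) (3 / 2 * n + 1)

/-- The initial point `r_ω⁰` of the edge `Γ_ω`. -/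
def edgeStart (N : ℕ) : Edge N → EuclideanSpace ℝ (Fin 3) := fun (n, j, k) =>
  if j = 0 then lowerVertex N n k
  else if j = 1 then upperVertex N n k
  else lowerVertex N (n + 1) k

/-- The final point `r_ω¹` of the edge `Γ_ω`. -/
def edgeEnd (N : ℕ) : Edge N → EuclideanSpace ℝ (Fin 3) := fun (n, j, k) =>
  if j = 0 then upperVertex N n k
  else if j = 1 then lowerVertex N (n + 1) k
  else upperVertex N n (k + 1)

/-- The vector potential `𝒜(x) = (B/2)(-x₂, x₁, 0)` of the field `B(0,0,1)`. -/
def vectorPotential (B : ℝ) (x : EuclideanSpace ℝ (Fin 3)) : EuclideanSpace ℝ (Fin 3) :=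
  (B / 2) • !₂[-x 1, x 0, 0]

/-- The tangential component `a_ω(t) = (𝒜(r_ω⁰ + t e_ω), e_ω)`, `e_ω = r_ω¹ - r_ω⁰`, of the vector
potential along the edge `Γ_ω`. -/
def edgePotential (N : ℕ) (B : ℝ) (ω : Edge N) (t : ℝ) : ℝ :=
  inner ℝ (vectorPotential B (edgeStart N ω + t • (edgeEnd N ω - edgeStart N ω)))
    (edgeEnd N ω - edgeStart N ω)

/-- The value of the tangential vector potential along each non-vertical edge of the tube. -/
def tubeFlux (N : ℕ) (B : ℝ) : ℝ := 3 * B / 16 * Real.cot (Real.pi / (2 * N))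

/-- The Kirchhoff magnetic conditions on `Γ^(N)`: here `v` holds the values of `f` and `d` those of
`∂f` at the ends of the edges; `f` is continuous at every vertex, and the outgoing magnetic
derivatives at every vertex add up to zero. -/
def kirchhoff (N : ℕ) : Submodule ℂ (BoundaryData (Edge N)) where
  carrier := {p | ∀ (n : ℤ) (k : ZMod N),
    (p.1 (n, 0, k) 1 = p.1 (n, 1, k) 0 ∧ p.1 (n, 1, k) 0 = p.1 (n, 2, k - 1) 1) ∧
    (p.1 (n + 1, 0, k) 0 = p.1 (n, 1, k) 1 ∧ p.1 (n, 1, k) 1 = p.1 (n, 2, k) 0) ∧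
    -p.2 (n, 0, k) 1 + p.2 (n, 1, k) 0 - p.2 (n, 2, k - 1) 1 = 0 ∧
    p.2 (n + 1, 0, k) 0 - p.2 (n, 1, k) 1 + p.2 (n, 2, k) 0 = 0}
  add_mem' := by
    intro p r hp hr n k
    obtain ⟨⟨a, b⟩, ⟨c, d⟩, e, g⟩ := hp n k
    obtain ⟨⟨a', b'⟩, ⟨c', d'⟩, e', g'⟩ := hr n k
    simp only [Prod.fst_add, Prod.snd_add, Pi.add_apply]
    exact ⟨⟨by linear_combination a + a', by linear_combination b + b'⟩,
      ⟨by linear_combination c + c', by linear_combination d + d'⟩,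
      by linear_combination e + e', by linear_combination g + g'⟩
  zero_mem' := by
    intro n k
    simp
  smul_mem' := by
    intro z p hp n k
    obtain ⟨⟨a, b⟩, ⟨c, d⟩, e, g⟩ := hp n k
    simp only [Prod.smul_fst, Prod.smul_snd, Pi.smul_apply, smul_eq_mul]
    exact ⟨⟨by linear_combination z * a, by linear_combination z * b⟩,
      ⟨by linear_combination z * c, by linear_combination z * d⟩,
      by linear_combination z * e, by linear_combination z * g⟩

/-- The magnetic Schrödinger operator `𝓗 = (-i∇ - 𝒜)² + q` on the tube `Γ^(N)`. -/
def magneticOp (N : ℕ) (B : ℝ) (q : ℝ → ℝ) : GraphL2 (Edge N) →ₗ.[ℂ] GraphL2 (Edge N) :=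
  schrodingerOp (edgePotential N B) q (kirchhoff N)

/-! ### The operators `H_k` on `Γ^(1)` -/

/-- The index set `ℤ × ℤ₃` of the edges of `Γ^(1)`. -/
abbrev Edge₁ : Type := ℤ × ZMod 3

/-- `s^k`, where `s = exp(2πi/N)`. -/
def sPow (N : ℕ) (k : ℤ) : ℂ := exp (2 * Real.pi * k / N * I)

/-- `s^{-k/2} = exp(-πik/N)`. -/
def sNegHalfPow (N : ℕ) (k : ℤ) : ℂ := exp (-(Real.pi * k / N * I))

/-- `c_k = cos(a + πk/N)`. -/
def cCoef (N : ℕ) (a : ℝ) (k : ℤ) : ℝ := Real.cos (a + Real.pi * k / N)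

/-- `s_k = sin(a + πk/N)`. -/
def sCoef (N : ℕ) (a : ℝ) (k : ℤ) : ℝ := Real.sin (a + Real.pi * k / N)

/-- The twisted Kirchhoff conditions on `Γ^(1)`: for the values `v` of `f` and `d` of `f'` at the
ends of the edges,
`v_{n,0}(1) = v_{n,1}(0) = e^{ia} s^k v_{n,2}(1)`, `v_{n+1,0}(0) = e^{ia} v_{n,1}(1) = v_{n,2}(0)`,
`-d_{n,0}(1) + d_{n,1}(0) - e^{ia} s^k d_{n,2}(1) = 0`,
`d_{n+1,0}(0) - e^{ia} d_{n,1}(1) + d_{n,2}(0) = 0`. -/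
def twistedKirchhoff (N : ℕ) (a : ℝ) (k : ℤ) : Submodule ℂ (BoundaryData Edge₁) where
  carrier := {p | ∀ n : ℤ,
    (p.1 (n, 0) 1 = p.1 (n, 1) 0 ∧ p.1 (n, 1) 0 = exp (I * a) * sPow N k * p.1 (n, 2) 1) ∧
    (p.1 (n + 1, 0) 0 = exp (I * a) * p.1 (n, 1) 1 ∧
      exp (I * a) * p.1 (n, 1) 1 = p.1 (n, 2) 0) ∧
    -p.2 (n, 0) 1 + p.2 (n, 1) 0 - exp (I * a) * sPow N k * p.2 (n, 2) 1 = 0 ∧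
    p.2 (n + 1, 0) 0 - exp (I * a) * p.2 (n, 1) 1 + p.2 (n, 2) 0 = 0}
  add_mem' := by
    intro p r hp hr n
    obtain ⟨⟨a, b⟩, ⟨c, d⟩, e, g⟩ := hp n
    obtain ⟨⟨a', b'⟩, ⟨c', d'⟩, e', g'⟩ := hr n
    simp only [Prod.fst_add, Prod.snd_add, Pi.add_apply]
    exact ⟨⟨by linear_combination a + a', by linear_combination b + b'⟩,
      ⟨by linear_combination c + c', by linear_combination d + d'⟩,
      by linear_combination e + e', by linear_combination g + g'⟩
  zero_mem' := by
    intro n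
    simp
  smul_mem' := by
    intro z p hp n
    obtain ⟨⟨a, b⟩, ⟨c, d⟩, e, g⟩ := hp n
    simp only [Prod.smul_fst, Prod.smul_snd, Pi.smul_apply, smul_eq_mul]
    exact ⟨⟨by linear_combination z * a, by linear_combination z * b⟩,
      ⟨by linear_combination z * c, by linear_combination z * d⟩,
      by linear_combination z * e, by linear_combination z * g⟩

/-- The operator `H_k = H_k(a)`, acting as `-f'' + q f` in `L²(Γ^(1))`. -/
def twistedOp (N : ℕ) (a : ℝ) (q : ℝ → ℝ) (k : ℤ) : GraphL2 Edge₁ →ₗ.[ℂ] GraphL2 Edge₁ :=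
  schrodingerOp (fun _ _ => 0) q (twistedKirchhoff N a k)

/-- `f`, with derivative `df`, solves `-f'' + q f = lam f` on every edge of `Γ^(1)` and satisfies
the twisted Kirchhoff conditions (no growth condition at infinity). -/
def IsGraphSolution (N : ℕ) (a : ℝ) (q : ℝ → ℝ) (k : ℤ) (lam : ℂ) (f df : Edge₁ → ℝ → ℂ) : Prop :=
  (∀ ω, IsODESolution q lam (f ω) (df ω)) ∧ (endpoints f, endpoints df) ∈ twistedKirchhoff N a k

/-- `f`, with derivative `df`, is the unique (on `Γ^(1)`) solution in the sense of
`IsGraphSolution` with `f_{0,0}(0) = c₀` and `f_{0,0}'(0) = c₁`. -/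
def IsUniqueGraphSolution (N : ℕ) (a : ℝ) (q : ℝ → ℝ) (k : ℤ) (lam c₀ c₁ : ℂ)
    (f df : Edge₁ → ℝ → ℂ) : Prop :=
  IsGraphSolution N a q k lam f df ∧ f (0, 0) 0 = c₀ ∧ df (0, 0) 0 = c₁ ∧
    ∀ g dg : Edge₁ → ℝ → ℂ, IsGraphSolution N a q k lam g dg →
      g (0, 0) 0 = c₀ → dg (0, 0) 0 = c₁ →
      ∀ ω, ∀ t ∈ Set.Icc (0 : ℝ) 1, g ω t = f ω t ∧ dg ω t = df ω t

/-- The monodromy matrix of a pair `Θ`, `Φ` of functions on `Γ^(1)` with derivatives `dΘ`, `dΦ`: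
their values and derivatives at the initial point of the edge `Γ_{1,0}`. -/
def graphMonodromy (Θ dΘ Φ dΦ : Edge₁ → ℝ → ℂ) : Matrix (Fin 2) (Fin 2) ℂ :=
  !![Θ (1, 0) 0, Φ (1, 0) 0; dΘ (1, 0) 0, dΦ (1, 0) 0]

/-- `T_k = (s^{-k/2} / 2c_k) [2Δ, 1; 4Δ² - 4c_k², 2Δ]`. -/
def transferMatrix (N : ℕ) (a : ℝ) (q : ℝ → ℝ) (k : ℤ) (lam : ℂ) : Matrix (Fin 2) (Fin 2) ℂ :=
  (sNegHalfPow N k / (2 * (cCoef N a k : ℂ))) •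
    !![2 * lyapunov q lam, 1;
      4 * lyapunov q lam ^ 2 - 4 * (cCoef N a k : ℂ) ^ 2, 2 * lyapunov q lam]

/-- `R = diag(1, φ(1, lam))`. -/
def scalingMatrix (q : ℝ → ℝ) (lam : ℂ) : Matrix (Fin 2) (Fin 2) ℂ :=
  !![1, 0; 0, varphi q 1 lam]

end ZigzagTube

end

open MeasureTheory Complex

noncomputable section

namespace ZigzagTube

/-! ### Absolutely continuous functions on the unit interval -/

/-! Part (i). The potential `𝒜` is linear and antisymmetric, so its tangential component is constant
along each edge and equals `B/2` times the planar cross product of the two endpoints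
(`edgePotential_eq`): zero on vertical edges, and `B/2 · R² sin(π/N)` on slanted ones
(`tubeFlux_eq`). A constant potential `a` on an edge is gauged away by `exp(-iat)`
(`HasMagDeriv.phase_mul`); the only trace is a factor `exp(ia)` in the vertex conditions at ends `t
= 1`. The remaining coupling between different `k` is the shift `k ↦ k - 1`, which the discrete
Fourier transform on `ℤ/N` turns into multiplication by `s^k`. Gauge and Fourier transform are
unitary and act at each `t` separately, so they commute with `q`. Unbounded operators are compared
through their graphs (`mem_schrodingerGraph_iff_tubeUnitary`, `unitarilyEquivalent_of_graph`).

Part (ii). Off `σ_D` one has `φ(1) ≠ 0`, so a solution on an edge is determined by its values at the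
two ends. Continuity thus expresses the solution on the edges `(n,1)`, `(n,2)` through the value `X`
at the end of `(n,0)` and the value `Z` at the start of `(n+1,0)`. The first derivative condition is
then a linear equation for `Z` whose leading coefficient is a nonzero multiple of `c_k`, and the
second gives the derivative at the start of `(n+1,0)`. Hence data on vertical edges propagate by
`R⁻¹ T_k R M` (`kirchhoff_iff_transfer`). This matrix has determinant `s^{-k} ≠ 0`, so its integer
powers give exactly one solution for prescribed data on `(0,0)` (`eq_graphData_iff`).

Dependence on `lam`: the fundamental solutions are entire, because they come from inverting `1 - K`
with `K` a Volterra operator affine in `lam` (`differentiable_ivpSolution`). Everything else is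
built from them by algebra, with denominators that do not vanish off `σ_D`. In the trace and
determinant of the cell matrix the denominator `φ(1)` drops out, so the characteristic polynomial is
entire. -/

lemma uIcc_zero_subset {t : ℝ} (ht : t ∈ Set.Icc (0 : ℝ) 1) :
    Set.uIcc (0 : ℝ) t ⊆ Set.uIcc 0 1 :=
  Set.uIcc_subset_uIcc_left (by simpa using ht)

lemma absolutelyContinuousOnInterval_ofReal {f : ℝ → ℝ} {a b : ℝ}
    (h : AbsolutelyContinuousOnInterval f a b) :
    AbsolutelyContinuousOnInterval (fun x => (f x : ℂ)) a b := by
  have h1 : AbsolutelyContinuousOnInterval (fun _ : ℝ => (1 : ℂ)) a b :=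
    contDiffOn_const.absolutelyContinuousOnInterval
  have h2 : (fun x => (f x : ℂ)) = f • (fun _ : ℝ => (1 : ℂ)) := by
    funext x
    simp
  rw [h2]
  exact h.smul h1

lemma intervalIntegrable_ofReal {g : ℝ → ℝ} {a b : ℝ} (hg : IntervalIntegrable g volume a b) :
    IntervalIntegrable (fun x => (g x : ℂ)) volume a b :=
  ⟨hg.1.ofReal, hg.2.ofReal⟩

/-- Real and imaginary parts are primitives of real integrable functions, for which absolute
continuity is known. -/
lemma absolutelyContinuousOnInterval_primitive {g : ℝ → ℂ}
    (hg : IntervalIntegrable g volume 0 1) (c : ℂ) :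
    AbsolutelyContinuousOnInterval (fun t => c + ∫ x in (0 : ℝ)..t, g x) 0 1 := by
  have hre : IntervalIntegrable (fun x => (g x).re) volume 0 1 :=
    ⟨hg.1.re, hg.2.re⟩
  have him : IntervalIntegrable (fun x => (g x).im) volume 0 1 :=
    ⟨hg.1.im, hg.2.im⟩
  have a1 := absolutelyContinuousOnInterval_ofReal
    (hre.absolutelyContinuousOnInterval_intervalIntegral (c := 0) (by simp))
  have a2 := (absolutelyContinuousOnInterval_ofReal
    (him.absolutelyContinuousOnInterval_intervalIntegral (c := 0) (by simp))).const_smul I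
  have a3 : AbsolutelyContinuousOnInterval (fun _ : ℝ => c) 0 1 :=
    contDiffOn_const.absolutelyContinuousOnInterval
  have a4 := a3.add (a1.add a2)
  have hEq : Set.EqOn ((fun _ : ℝ => c) + ((fun x => ((∫ v in (0 : ℝ)..x, (g v).re : ℝ) : ℂ)) +
      fun x => I • ((∫ v in (0 : ℝ)..x, (g v).im : ℝ) : ℂ)))
      (fun t => c + ∫ x in (0 : ℝ)..t, g x) (Set.Icc 0 1) := by
    intro t ht
    have hs := uIcc_zero_subset ht
    simp only [Pi.add_apply]
    congr 1
    rw [← intervalIntegral.integral_ofReal, ← intervalIntegral.integral_ofReal, smul_eq_mul,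
      ← intervalIntegral.integral_const_mul, ← intervalIntegral.integral_add]
    · refine intervalIntegral.integral_congr fun x _ => ?_
      simp [mul_comm I]
    · exact intervalIntegrable_ofReal (hre.mono_set hs)
    · exact (intervalIntegrable_ofReal (him.mono_set hs)).const_mul I
  -- Absolute continuity only evaluates the function at points of `[0,1]`, so the equality `hEq`
  -- there is enough to transfer it.
  rw [absolutelyContinuousOnInterval_iff] at a4 ⊢
  intro ε hε
  obtain ⟨δ, hδ, H⟩ := a4 ε hε
  refine ⟨δ, hδ, fun E hE hEδ => ?_⟩
  refine lt_of_eq_of_lt (Finset.sum_congr rfl fun i hi => ?_) (H E hE hEδ)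
  have hi' := hE.1 i hi
  rw [Set.uIcc_of_le zero_le_one] at hi'
  rw [hEq hi'.1, hEq hi'.2]

/-- The product minus the primitive of the expected derivative is absolutely continuous with
derivative zero almost everywhere, hence constant. -/
lemma HasACDeriv.mul {f₁ f₂ g₁ g₂ : ℝ → ℂ} (h₁ : HasACDeriv f₁ g₁) (h₂ : HasACDeriv f₂ g₂) :
    HasACDeriv (fun t => f₁ t * f₂ t) (fun t => g₁ t * f₂ t + f₁ t * g₂ t) := by
  have c1 : ContinuousOn f₁ (Set.uIcc 0 1) := by simpa using h₁.continuousOn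
  have c2 : ContinuousOn f₂ (Set.uIcc 0 1) := by simpa using h₂.continuousOn
  have hint : IntervalIntegrable (fun t => g₁ t * f₂ t + f₁ t * g₂ t) volume 0 1 :=
    (h₁.1.mul_continuousOn c2).add (h₂.1.continuousOn_mul c1)
  refine ⟨hint, ?_⟩
  have e1 := h₁.2
  have e2 := h₂.2
  -- The functions `f₁`, `f₂` are controlled only on `[0,1]`; the primitives agree with them there
  -- and are differentiable almost everywhere in that interval.
  set F₁ : ℝ → ℂ := fun t => f₁ 0 + ∫ x in (0 : ℝ)..t, g₁ x with hF₁
  set F₂ : ℝ → ℂ := fun t => f₂ 0 + ∫ x in (0 : ℝ)..t, g₂ x with hF₂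
  have A1 : AbsolutelyContinuousOnInterval F₁ 0 1 :=
    absolutelyContinuousOnInterval_primitive h₁.1 _
  have A2 : AbsolutelyContinuousOnInterval F₂ 0 1 :=
    absolutelyContinuousOnInterval_primitive h₂.1 _
  have A3 := absolutelyContinuousOnInterval_primitive hint 0
  have A := (A1.smul A2).sub A3
  obtain ⟨C, hC⟩ := A.const_of_ae_hasDerivAt_zero (by
    filter_upwards [h₁.1.ae_hasDerivAt_integral, h₂.1.ae_hasDerivAt_integral,
      hint.ae_hasDerivAt_integral] with x d1 d2 d3 hx
    have d1' := (d1 hx 0 (by simp)).const_add (f₁ 0)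
    have d2' := (d2 hx 0 (by simp)).const_add (f₂ 0)
    have d3' := (d3 hx 0 (by simp)).const_add 0
    have hx' : x ∈ Set.Icc (0 : ℝ) 1 := by simpa using hx
    have hd := (d1'.mul d2').sub d3'
    rw [show (f₁ 0 + ∫ x in (0 : ℝ)..x, g₁ x) = f₁ x from (e1 x hx').symm,
      show (f₂ 0 + ∫ x in (0 : ℝ)..x, g₂ x) = f₂ x from (e2 x hx').symm, sub_self] at hd
    exact hd)
  intro t ht
  have h0 := hC 0 (by simp)
  have h1 := hC t (by simpa using ht)
  rw [← h0] at h1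
  have hF0 : (F₁ • F₂) 0 = f₁ 0 * f₂ 0 := by
    simp [hF₁, hF₂]
  have hFt : (F₁ • F₂) t = f₁ t * f₂ t := by
    rw [e1 t ht, e2 t ht]
    rfl
  simp only [Pi.sub_apply, hF0, hFt,
    intervalIntegral.integral_same, zero_add, sub_zero] at h1
  linear_combination h1

lemma HasACDeriv.pow {f g : ℝ → ℂ} (h : HasACDeriv f g) (n : ℕ) :
    HasACDeriv (fun t => f t ^ (n + 1)) (fun t => (n + 1) * f t ^ n * g t) := by
  induction n with
  | zero => simpa using h
  | succ n ih =>
    have := ih.mul h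
    convert this using 2 <;> push_cast <;> ring

/-- With `G` the primitive of `g`, the integrand is the derivative of `G^(n+1)/(n+1)`. This produces
the factorial in the bound for iterated Volterra operators. -/
lemma integral_pow_primitive_mul {g : ℝ → ℝ} (hg : IntervalIntegrable g volume 0 1) (n : ℕ)
    {t : ℝ} (ht : t ∈ Set.Icc (0 : ℝ) 1) :
    ∫ s in (0 : ℝ)..t, g s * (∫ x in (0 : ℝ)..s, g x) ^ n =
      (∫ x in (0 : ℝ)..t, g x) ^ (n + 1) / (n + 1) := by
  have h : HasACDeriv (fun t => ((∫ x in (0 : ℝ)..t, g x : ℝ) : ℂ)) (fun t => (g t : ℂ)) := by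
    refine ⟨intervalIntegrable_ofReal hg, fun t _ => ?_⟩
    rw [intervalIntegral.integral_ofReal]
    simp
  have h2 := (h.pow n).2 t ht
  rw [eq_div_iff (by positivity), mul_comm, ← intervalIntegral.integral_const_mul]
  apply ofReal_injective
  rw [← intervalIntegral.integral_ofReal]
  simp only [intervalIntegral.integral_same, ofReal_zero, ne_eq, Nat.add_eq_zero_iff, one_ne_zero,
    and_false, not_false_eq_true, zero_pow, zero_add] at h2
  push_cast
  rw [h2]
  refine intervalIntegral.integral_congr fun x _ => ?_
  ring

/-! ### Volterra operators -/

section Volterra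

variable {E : Type*} [NormedAddCommGroup E]

/-- A continuous function on the unit interval, extended by constants. -/
def extendIcc (Y : C(Set.Icc (0 : ℝ) 1, E)) : ℝ → E :=
  Set.IccExtend zero_le_one Y

lemma extendIcc_apply (Y : C(Set.Icc (0 : ℝ) 1, E)) (t : Set.Icc (0 : ℝ) 1) :
    extendIcc Y t = Y t := Set.IccExtend_val _ _ t

lemma continuous_extendIcc (Y : C(Set.Icc (0 : ℝ) 1, E)) : Continuous (extendIcc Y) :=
  Y.continuous.Icc_extend' (h := zero_le_one)

lemma norm_extendIcc_le (Y : C(Set.Icc (0 : ℝ) 1, E)) (s : ℝ) : ‖extendIcc Y s‖ ≤ ‖Y‖ :=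
  Y.norm_coe_le_norm _

variable [NormedSpace ℂ E]

lemma intervalIntegrable_clm_apply {V : ℝ → E →L[ℂ] E} (hV : IntervalIntegrable V volume 0 1)
    {Y : ℝ → E} (hY : ContinuousOn Y (Set.Icc 0 1)) :
    IntervalIntegrable (fun s => V s (Y s)) volume 0 1 := by
  rw [intervalIntegrable_iff_integrableOn_Icc_of_le zero_le_one] at hV ⊢
  obtain ⟨C, hC⟩ := isCompact_Icc.exists_bound_of_continuousOn hY
  refine ContinuousLinearMap.integrable_of_bilin_of_bdd_right
    (ContinuousLinearMap.id ℂ (E →L[ℂ] E)) C hV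
    (hY.aestronglyMeasurable measurableSet_Icc) ?_
  exact (ae_restrict_iff' measurableSet_Icc).2 (Filter.Eventually.of_forall hC)

lemma intervalIntegrable_clm_extendIcc {V : ℝ → E →L[ℂ] E} (hV : IntervalIntegrable V volume 0 1)
    (Y : C(Set.Icc (0 : ℝ) 1, E)) (t : Set.Icc (0 : ℝ) 1) :
    IntervalIntegrable (fun s => V s (extendIcc Y s)) volume 0 t :=
  (intervalIntegrable_clm_apply hV (continuous_extendIcc Y).continuousOn).mono_set
    (uIcc_zero_subset t.2)

lemma continuous_volterra {V : ℝ → E →L[ℂ] E} (hV : IntervalIntegrable V volume 0 1)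
    (Y : C(Set.Icc (0 : ℝ) 1, E)) :
    Continuous fun t : Set.Icc (0 : ℝ) 1 => ∫ s in (0 : ℝ)..t, V s (extendIcc Y s) := by
  have := intervalIntegral.continuousOn_primitive_interval'
    (intervalIntegrable_clm_apply hV (continuous_extendIcc Y).continuousOn) (a := 0) (by simp)
  rw [Set.uIcc_of_le zero_le_one] at this
  exact continuousOn_iff_continuous_domRestrict.1 this

lemma norm_integral_clm_extendIcc_le {V : ℝ → E →L[ℂ] E} (hV : IntervalIntegrable V volume 0 1)
    (Y : C(Set.Icc (0 : ℝ) 1, E)) (t : Set.Icc (0 : ℝ) 1) :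
    ‖∫ s in (0 : ℝ)..t, V s (extendIcc Y s)‖ ≤ (∫ s in (0 : ℝ)..1, ‖V s‖) * ‖Y‖ := by
  have h1 : ‖∫ s in (0 : ℝ)..t, V s (extendIcc Y s)‖ ≤ ∫ s in (0 : ℝ)..t, ‖V s‖ * ‖Y‖ := by
    refine intervalIntegral.norm_integral_le_of_norm_le t.2.1
      (Filter.Eventually.of_forall fun s _ => ?_)
      ((hV.norm.mono_set (uIcc_zero_subset t.2)).mul_const _)
    exact (V s).le_opNorm_of_le (norm_extendIcc_le Y s)
  refine h1.trans ?_
  rw [intervalIntegral.integral_mul_const]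
  gcongr
  exact intervalIntegral.integral_mono_interval le_rfl t.2.1 t.2.2
    (Filter.Eventually.of_forall fun _ => norm_nonneg _) hV.norm

/-- The Volterra operator `Y ↦ ∫₀ᵗ V(s) Y(s) ds` on the continuous functions on `[0,1]`. -/
def volterra (V : ℝ → E →L[ℂ] E) (hV : IntervalIntegrable V volume 0 1) :
    C(Set.Icc (0 : ℝ) 1, E) →L[ℂ] C(Set.Icc (0 : ℝ) 1, E) :=
  LinearMap.mkContinuous
    { toFun := fun Y => ⟨fun t => ∫ s in (0 : ℝ)..t, V s (extendIcc Y s), continuous_volterra hV Y⟩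
      map_add' := fun Y Z => by
        ext t
        refine Eq.trans ?_ (intervalIntegral.integral_add (intervalIntegrable_clm_extendIcc hV Y t)
          (intervalIntegrable_clm_extendIcc hV Z t))
        refine intervalIntegral.integral_congr fun s _ => ?_
        simp [extendIcc, Set.IccExtend]
      map_smul' := fun c Y => by
        ext t
        refine Eq.trans ?_ (intervalIntegral.integral_smul c _)
        refine intervalIntegral.integral_congr fun s _ => ?_
        simp [extendIcc, Set.IccExtend] }
    (∫ s in (0 : ℝ)..1, ‖V s‖) fun Y => by
      have h0 : 0 ≤ ∫ s in (0 : ℝ)..1, ‖V s‖ :=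
        intervalIntegral.integral_nonneg zero_le_one fun _ _ => norm_nonneg _
      exact (ContinuousMap.norm_le _ (by positivity)).2 fun t =>
        norm_integral_clm_extendIcc_le hV Y t

lemma volterra_apply (V : ℝ → E →L[ℂ] E) (hV : IntervalIntegrable V volume 0 1)
    (Y : C(Set.Icc (0 : ℝ) 1, E)) (t : Set.Icc (0 : ℝ) 1) :
    volterra V hV Y t = ∫ s in (0 : ℝ)..t, V s (extendIcc Y s) := rfl

/-- The bound must be kept pointwise in `t` for the induction: integrating the `n`-th bound against
`‖V‖` gives the next one by `integral_pow_primitive_mul`. -/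
lemma norm_volterra_pow_apply_le (V : ℝ → E →L[ℂ] E) (hV : IntervalIntegrable V volume 0 1)
    (Y : C(Set.Icc (0 : ℝ) 1, E)) (n : ℕ) (t : Set.Icc (0 : ℝ) 1) :
    ‖(volterra V hV ^ n) Y t‖ ≤ (∫ s in (0 : ℝ)..t, ‖V s‖) ^ n / n.factorial * ‖Y‖ := by
  induction n generalizing t with
  | zero => simpa using Y.norm_coe_le_norm t
  | succ n ih =>
    rw [pow_succ', mul_apply_eq_comp, volterra_apply]
    set Z := (volterra V hV ^ n) Y
    have hG : ContinuousOn (fun s => ∫ x in (0 : ℝ)..s, ‖V x‖) (Set.uIcc 0 t) :=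
      (intervalIntegral.continuousOn_primitive_interval' hV.norm (a := 0) (by simp)).mono
        (uIcc_zero_subset t.2)
    have hVt : IntervalIntegrable (fun s => ‖V s‖) volume 0 t :=
      hV.norm.mono_set (uIcc_zero_subset t.2)
    have h1 : ‖∫ s in (0 : ℝ)..t, V s (extendIcc Z s)‖ ≤
        ∫ s in (0 : ℝ)..t, ‖V s‖ * (∫ x in (0 : ℝ)..s, ‖V x‖) ^ n * (‖Y‖ / n.factorial) := by
      refine intervalIntegral.norm_integral_le_of_norm_le t.2.1
        (Filter.Eventually.of_forall fun s hs => ?_)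
        ((hVt.mul_continuousOn (hG.pow n)).mul_const _)
      have hs' : s ∈ Set.Icc (0 : ℝ) 1 := ⟨hs.1.le, hs.2.trans t.2.2⟩
      have h2 : ‖extendIcc Z s‖ ≤ _ := (extendIcc_apply Z ⟨s, hs'⟩) ▸ ih ⟨s, hs'⟩
      refine ((V s).le_opNorm_of_le h2).trans (le_of_eq ?_)
      ring
    refine h1.trans (le_of_eq ?_)
    rw [intervalIntegral.integral_mul_const, integral_pow_primitive_mul hV.norm n t.2,
      Nat.factorial_succ]
    push_cast
    field_simp

/-- No smallness of `V` is required: since `Cⁿ/n! → 0`, some power `Kⁿ` has norm below one, so `1 -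
Kⁿ` is invertible, and `1 - K` is one of its two commuting factors. -/
lemma isUnit_one_sub_volterra [CompleteSpace E] (V : ℝ → E →L[ℂ] E)
    (hV : IntervalIntegrable V volume 0 1) : IsUnit (1 - volterra V hV) := by
  set C := ∫ s in (0 : ℝ)..1, ‖V s‖ with hC
  have hC0 : 0 ≤ C := intervalIntegral.integral_nonneg zero_le_one fun _ _ => norm_nonneg _
  obtain ⟨n, hn⟩ := ((FloorSemiring.tendsto_pow_div_factorial_atTop C).eventually
    (gt_mem_nhds zero_lt_one)).exists
  have hlt : ‖volterra V hV ^ n‖ < 1 := by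
    refine lt_of_le_of_lt (ContinuousLinearMap.opNorm_le_bound _ (by positivity) fun Y => ?_) hn
    refine (ContinuousMap.norm_le _ (by positivity)).2 fun t => ?_
    refine (norm_volterra_pow_apply_le V hV Y n t).trans ?_
    gcongr
    · exact intervalIntegral.integral_nonneg t.2.1 fun _ _ => norm_nonneg _
    · exact intervalIntegral.integral_mono_interval le_rfl t.2.1 t.2.2
        (Filter.Eventually.of_forall fun _ => norm_nonneg _) hV.norm
  have hu : IsUnit (1 - volterra V hV ^ n) := (Units.oneSub (volterra V hV ^ n) hlt).isUnit
  have hcomm : Commute (1 - volterra V hV) (∑ i ∈ Finset.range n, volterra V hV ^ i) :=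
    (Commute.sum_right _ _ _ fun i _ =>
      (Commute.one_left _).sub_left (Commute.self_pow _ i))
  rw [← mul_neg_geom_sum] at hu
  exact (hcomm.isUnit_mul_iff.1 hu).1

end Volterra

/-! ### The scalar equation on the unit interval -/

/-- The map `(y, z) ↦ (z, 0)`. -/
def shiftLeft : ℂ × ℂ →L[ℂ] ℂ × ℂ :=
  (ContinuousLinearMap.inl ℂ ℂ ℂ).comp (ContinuousLinearMap.snd ℂ ℂ ℂ)

/-- The map `(y, z) ↦ (0, y)`. -/
def shiftRight : ℂ × ℂ →L[ℂ] ℂ × ℂ :=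
  (ContinuousLinearMap.inr ℂ ℂ ℂ).comp (ContinuousLinearMap.fst ℂ ℂ ℂ)

/-- The coefficient of the first order system `(y, z)' = (z, (q - lam) y)`. -/
def systemCoeff (q : ℝ → ℝ) (lam : ℂ) (s : ℝ) : ℂ × ℂ →L[ℂ] ℂ × ℂ :=
  shiftLeft + ((q s : ℂ) - lam) • shiftRight

lemma systemCoeff_apply (q : ℝ → ℝ) (lam : ℂ) (s : ℝ) (p : ℂ × ℂ) :
    systemCoeff q lam s p = (p.2, ((q s : ℂ) - lam) * p.1) := by
  simp [systemCoeff, shiftLeft, shiftRight]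

lemma intervalIntegrable_potential {q : ℝ → ℝ} (hq : MemLp q 2 unitMeasure) :
    IntervalIntegrable q volume 0 1 := by
  rw [intervalIntegrable_iff_integrableOn_Icc_of_le zero_le_one]
  exact hq.integrable one_le_two

lemma intervalIntegrable_systemCoeff {q : ℝ → ℝ} (hq : IntervalIntegrable q volume 0 1) (lam : ℂ) :
    IntervalIntegrable (systemCoeff q lam) volume 0 1 :=
  intervalIntegrable_const.add
    (((intervalIntegrable_ofReal hq).sub intervalIntegrable_const).smul_continuousOn
      continuousOn_const)

/-- The dependence on `lam` is affine, with bounded operator coefficients; this is what makes the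
solutions entire in `lam`. -/
lemma volterra_systemCoeff {q : ℝ → ℝ} (hq : IntervalIntegrable q volume 0 1) (lam : ℂ) :
    volterra (systemCoeff q lam) (intervalIntegrable_systemCoeff hq lam) =
      volterra (systemCoeff q 0) (intervalIntegrable_systemCoeff hq 0) -
        lam • volterra (fun _ => shiftRight) intervalIntegrable_const := by
  ext Y t : 2
  have h1 := intervalIntegrable_clm_extendIcc (intervalIntegrable_systemCoeff hq 0) Y t
  have h2 : IntervalIntegrable (fun s => lam • shiftRight (extendIcc Y s)) volume 0 t :=
    (intervalIntegrable_clm_extendIcc (V := fun _ => shiftRight) intervalIntegrable_const Y t).smul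
      lam
  rw [sub_apply, smul_apply, ContinuousMap.sub_apply,
    ContinuousMap.smul_apply, volterra_apply, volterra_apply, volterra_apply,
    ← intervalIntegral.integral_smul, ← intervalIntegral.integral_sub h1 h2]
  refine intervalIntegral.integral_congr fun s _ => ?_
  simp [systemCoeff, sub_smul, add_sub_assoc]

/-- The solution of the first order system with initial value `p`. -/
def systemSolution {q : ℝ → ℝ} (hq : IntervalIntegrable q volume 0 1) (lam : ℂ) (p : ℂ × ℂ) :
    C(Set.Icc (0 : ℝ) 1, ℂ × ℂ) :=
  Ring.inverse (1 - volterra (systemCoeff q lam) (intervalIntegrable_systemCoeff hq lam))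
    (ContinuousMap.const _ p)

/-- An affine function of `lam` is composed with inversion, which is analytic at every unit of the
Banach algebra of bounded operators. -/
lemma differentiable_inverse_one_sub_apply {X : Type*} [NormedAddCommGroup X] [NormedSpace ℂ X]
    [CompleteSpace X] (K₀ K₁ : X →L[ℂ] X) (h : ∀ lam : ℂ, IsUnit (1 - (K₀ - lam • K₁))) (x : X) :
    Differentiable ℂ fun lam : ℂ => Ring.inverse (1 - (K₀ - lam • K₁)) x := by
  intro lam
  obtain ⟨u, hu⟩ := h lam
  have h1 : DifferentiableAt ℂ (fun lam : ℂ => 1 - (K₀ - lam • K₁)) lam := by fun_prop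
  have h2 : DifferentiableAt ℂ Ring.inverse (1 - (K₀ - lam • K₁)) := by
    rw [← hu]
    exact (analyticAt_inverse (𝕜 := ℂ) u).differentiableAt
  exact (h2.comp lam h1).clm_apply (differentiableAt_const x)

lemma differentiable_systemSolution {q : ℝ → ℝ} (hq : IntervalIntegrable q volume 0 1)
    (p : ℂ × ℂ) (t : Set.Icc (0 : ℝ) 1) :
    Differentiable ℂ fun lam => systemSolution hq lam p t := by
  have h := differentiable_inverse_one_sub_apply _ _ (fun lam => by
    rw [← volterra_systemCoeff hq lam]
    exact isUnit_one_sub_volterra _ _) (ContinuousMap.const (Set.Icc (0 : ℝ) 1) p)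
  have h2 := (ContinuousMap.evalCLM ℂ t).differentiable.comp h
  refine fun lam => (h2 lam).congr_of_eventuallyEq (Filter.Eventually.of_forall fun lam => ?_)
  simp only [Function.comp_apply, ← volterra_systemCoeff hq lam]
  rfl

/-- The integral equation is `(1 - K) Y = p`, and `1 - K` is invertible; this yields existence and
uniqueness together. -/
lemma systemSolution_eq {q : ℝ → ℝ} (hq : IntervalIntegrable q volume 0 1) (lam : ℂ) (p : ℂ × ℂ)
    {Y : C(Set.Icc (0 : ℝ) 1, ℂ × ℂ)} :
    Y = systemSolution hq lam p ↔
      ∀ t : Set.Icc (0 : ℝ) 1, Y t = p + ∫ s in (0 : ℝ)..t, systemCoeff q lam s (extendIcc Y s) := by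
  set K := volterra (systemCoeff q lam) (intervalIntegrable_systemCoeff hq lam) with hK
  have hu : IsUnit (1 - K) := isUnit_one_sub_volterra _ _
  have h : Y = systemSolution hq lam p ↔ (1 - K) Y = ContinuousMap.const _ p := by
    constructor
    · rintro rfl
      change ((1 - K) * Ring.inverse (1 - K)) _ = _
      rw [Ring.mul_inverse_cancel _ hu]
      rfl
    · intro h
      rw [systemSolution, ← h]
      change _ = (Ring.inverse (1 - K) * (1 - K)) Y
      rw [Ring.inverse_mul_cancel _ hu]
      rfl
  rw [h, ContinuousMap.ext_iff]
  refine forall_congr' fun t => ?_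
  change Y t - K Y t = p ↔ _
  rw [hK, volterra_apply, sub_eq_iff_eq_add]

lemma intervalIntegral_prod {f g : ℝ → ℂ} {a b : ℝ} (hf : IntervalIntegrable f volume a b)
    (hg : IntervalIntegrable g volume a b) :
    ∫ s in a..b, (f s, g s) = (∫ s in a..b, f s, ∫ s in a..b, g s) := by
  have h : IntervalIntegrable (fun s => (f s, g s)) volume a b :=
    ⟨hf.1.prodMk hg.1, hf.2.prodMk hg.2⟩
  ext1
  · exact ((ContinuousLinearMap.fst ℂ ℂ ℂ).intervalIntegral_comp_comm h).symm
  · exact ((ContinuousLinearMap.snd ℂ ℂ ℂ).intervalIntegral_comp_comm h).symm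

lemma isODESolution_systemSolution {q : ℝ → ℝ} (hq : IntervalIntegrable q volume 0 1) (lam : ℂ)
    (p : ℂ × ℂ) :
    IsODESolution q lam (fun t => (extendIcc (systemSolution hq lam p) t).1)
      (fun t => (extendIcc (systemSolution hq lam p) t).2) := by
  have h := (systemSolution_eq hq lam p).1 rfl
  set Y := systemSolution hq lam p
  have hc1 : Continuous fun t => (extendIcc Y t).1 := (continuous_extendIcc Y).fst
  have hc2 : Continuous fun t => (extendIcc Y t).2 := (continuous_extendIcc Y).snd
  have i1 : IntervalIntegrable (fun t => (extendIcc Y t).2) volume 0 1 := hc2.intervalIntegrable _ _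
  have i2 : IntervalIntegrable (fun t => ((q t : ℂ) - lam) * (extendIcc Y t).1) volume 0 1 :=
    ((intervalIntegrable_ofReal hq).sub intervalIntegrable_const).mul_continuousOn hc1.continuousOn
  have key (t : ℝ) (ht : t ∈ Set.Icc (0 : ℝ) 1) : extendIcc Y t = p +
      (∫ s in (0 : ℝ)..t, (extendIcc Y s).2,
        ∫ s in (0 : ℝ)..t, ((q s : ℂ) - lam) * (extendIcc Y s).1) := by
    rw [← intervalIntegral_prod (i1.mono_set (uIcc_zero_subset ht))
      (i2.mono_set (uIcc_zero_subset ht))]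
    have := h ⟨t, ht⟩
    simp only [systemCoeff_apply] at this
    rw [← this]
    exact extendIcc_apply Y ⟨t, ht⟩
  have h0 : extendIcc Y 0 = p := by
    simpa using (key 0 (by simp)).trans (by simp)
  refine ⟨⟨i1, fun t ht => ?_⟩, ⟨i2, fun t ht => ?_⟩⟩
  · beta_reduce
    rw [h0, key t ht]
    rfl
  · beta_reduce
    rw [h0, key t ht]
    rfl

lemma systemSolution_zero {q : ℝ → ℝ} (hq : IntervalIntegrable q volume 0 1) (lam : ℂ)
    (p : ℂ × ℂ) : extendIcc (systemSolution hq lam p) 0 = p := by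
  have h := (systemSolution_eq hq lam p).1 rfl ⟨0, by simp⟩
  rw [← extendIcc_apply] at h
  simpa using h

/-- Uniqueness for the initial value problem: the pair `(y, dy)` obeys the integral equation that
characterises `systemSolution`. -/
lemma IsODESolution.eq_systemSolution {q : ℝ → ℝ} (hq : IntervalIntegrable q volume 0 1) {lam : ℂ}
    {y dy : ℝ → ℂ} (h : IsODESolution q lam y dy) {t : ℝ} (ht : t ∈ Set.Icc (0 : ℝ) 1) :
    (y t, dy t) = systemSolution hq lam (y 0, dy 0) ⟨t, ht⟩ := by
  have c1 := h.1.continuousOn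
  have c2 := h.2.continuousOn
  let Y : C(Set.Icc (0 : ℝ) 1, ℂ × ℂ) := ⟨fun s => (y s, dy s),
    (continuousOn_iff_continuous_domRestrict.1 c1).prodMk
      (continuousOn_iff_continuous_domRestrict.1 c2)⟩
  have hY : Y = systemSolution hq lam (y 0, dy 0) := by
    rw [systemSolution_eq]
    intro s
    have hs := uIcc_zero_subset s.2
    have e : ∫ x in (0 : ℝ)..s, systemCoeff q lam x (extendIcc Y x) =
        ∫ x in (0 : ℝ)..s, (dy x, ((q x : ℂ) - lam) * y x) := by
      refine intervalIntegral.integral_congr fun x hx => ?_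
      have hx' : x ∈ Set.Icc (0 : ℝ) 1 := by simpa using hs hx
      have : extendIcc Y x = (y x, dy x) := extendIcc_apply Y ⟨x, hx'⟩
      simp only [this, systemCoeff_apply]
    rw [e, intervalIntegral_prod (h.1.1.mono_set hs) (h.2.1.mono_set hs)]
    exact Prod.ext (h.1.2 s s.2) (h.2.2 s s.2)
  rw [← hY]
  rfl

lemma ivpSolution_spec {q : ℝ → ℝ} (hq : IntervalIntegrable q volume 0 1) (lam c₀ c₁ : ℂ) :
    IsODESolution q lam (ivpSolution q lam c₀ c₁).1 (ivpSolution q lam c₀ c₁).2 ∧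
      (ivpSolution q lam c₀ c₁).1 0 = c₀ ∧ (ivpSolution q lam c₀ c₁).2 0 = c₁ := by
  have h0 := systemSolution_zero hq lam (c₀, c₁)
  exact Classical.epsilon_spec (p := fun p : (ℝ → ℂ) × (ℝ → ℂ) =>
    IsODESolution q lam p.1 p.2 ∧ p.1 0 = c₀ ∧ p.2 0 = c₁)
    ⟨(_, _), isODESolution_systemSolution hq lam (c₀, c₁), congrArg Prod.fst h0,
      congrArg Prod.snd h0⟩

/-- Although `ivpSolution` is an arbitrary choice made separately for each `lam`, on `[0,1]`
uniqueness forces it to be the Volterra solution, which is entire in `lam`. -/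
lemma differentiable_ivpSolution {q : ℝ → ℝ} (hq : IntervalIntegrable q volume 0 1) (c₀ c₁ : ℂ)
    {t : ℝ} (ht : t ∈ Set.Icc (0 : ℝ) 1) :
    Differentiable ℂ (fun lam => (ivpSolution q lam c₀ c₁).1 t) ∧
      Differentiable ℂ (fun lam => (ivpSolution q lam c₀ c₁).2 t) := by
  have h (lam : ℂ) : ((ivpSolution q lam c₀ c₁).1 t, (ivpSolution q lam c₀ c₁).2 t) =
      systemSolution hq lam (c₀, c₁) ⟨t, ht⟩ := by
    obtain ⟨h1, h2, h3⟩ := ivpSolution_spec hq lam c₀ c₁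
    rw [h1.eq_systemSolution hq ht, h2, h3]
  have hd := differentiable_systemSolution hq (c₀, c₁) ⟨t, ht⟩
  simp_rw [← h] at hd
  exact ⟨hd.fst, hd.snd⟩

lemma IsODESolution.smul_add_smul {q : ℝ → ℝ} {lam : ℂ} {y dy z dz : ℝ → ℂ}
    (hy : IsODESolution q lam y dy) (hz : IsODESolution q lam z dz) (a b : ℂ) :
    IsODESolution q lam (fun t => a * y t + b * z t) (fun t => a * dy t + b * dz t) := by
  refine ⟨(hy.1.smul a).add (hz.1.smul b), ?_⟩
  convert (hy.2.smul a).add (hz.2.smul b) using 2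
  ring

/-- The solution of `-y'' + q y = lam y` with initial data `p`, expressed through the fundamental
solutions. -/
def solutionOf (q : ℝ → ℝ) (lam : ℂ) (p : ℂ × ℂ) (t : ℝ) : ℂ :=
  p.1 * vartheta q t lam + p.2 * varphi q t lam

/-- The derivative of `solutionOf q lam p`. -/
def solutionOf' (q : ℝ → ℝ) (lam : ℂ) (p : ℂ × ℂ) (t : ℝ) : ℂ :=
  p.1 * vartheta' q t lam + p.2 * varphi' q t lam

section Fundamental

variable {q : ℝ → ℝ} (hq : IntervalIntegrable q volume 0 1) (lam : ℂ)
include hq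

lemma isODESolution_vartheta :
    IsODESolution q lam (fun t => vartheta q t lam) (fun t => vartheta' q t lam) :=
  (ivpSolution_spec hq lam 1 0).1

lemma isODESolution_varphi :
    IsODESolution q lam (fun t => varphi q t lam) (fun t => varphi' q t lam) :=
  (ivpSolution_spec hq lam 0 1).1

lemma vartheta_zero : vartheta q 0 lam = 1 := (ivpSolution_spec hq lam 1 0).2.1

lemma vartheta'_zero : vartheta' q 0 lam = 0 := (ivpSolution_spec hq lam 1 0).2.2

lemma varphi_zero : varphi q 0 lam = 0 := (ivpSolution_spec hq lam 0 1).2.1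

lemma varphi'_zero : varphi' q 0 lam = 1 := (ivpSolution_spec hq lam 0 1).2.2

lemma isODESolution_solutionOf (p : ℂ × ℂ) :
    IsODESolution q lam (solutionOf q lam p) (solutionOf' q lam p) :=
  (isODESolution_vartheta hq lam).smul_add_smul (isODESolution_varphi hq lam) p.1 p.2

lemma solutionOf_zero (p : ℂ × ℂ) : solutionOf q lam p 0 = p.1 := by
  simp [solutionOf, vartheta_zero hq, varphi_zero hq]

lemma solutionOf'_zero (p : ℂ × ℂ) : solutionOf' q lam p 0 = p.2 := by
  simp [solutionOf', vartheta'_zero hq, varphi'_zero hq]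

variable {lam} in
lemma IsODESolution.eq_solutionOf {y dy : ℝ → ℂ} (h : IsODESolution q lam y dy) {t : ℝ}
    (ht : t ∈ Set.Icc (0 : ℝ) 1) :
    y t = solutionOf q lam (y 0, dy 0) t ∧ dy t = solutionOf' q lam (y 0, dy 0) t := by
  have h1 := h.eq_systemSolution hq ht
  have h2 := (isODESolution_solutionOf hq lam (y 0, dy 0)).eq_systemSolution hq ht
  rw [solutionOf_zero hq, solutionOf'_zero hq, ← h1] at h2
  exact ⟨(congrArg Prod.fst h2).symm, (congrArg Prod.snd h2).symm⟩

/-- By the product rule the derivative of the Wronskian is an expression that cancels identically,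
so its value at `0` persists. -/
lemma wronskian_eq_one {t : ℝ} (ht : t ∈ Set.Icc (0 : ℝ) 1) :
    vartheta q t lam * varphi' q t lam - vartheta' q t lam * varphi q t lam = 1 := by
  have h1 := isODESolution_vartheta hq lam
  have h2 := isODESolution_varphi hq lam
  have h3 := ((h1.1.mul h2.2).add ((h1.2.mul h2.1).smul (-1))).2 t ht
  have h4 : ∀ x, (vartheta' q x lam * varphi' q x lam +
      vartheta q x lam * ((q x - lam) * varphi q x lam)) +
      -1 * ((q x - lam) * vartheta q x lam * varphi q x lam +
        vartheta' q x lam * varphi' q x lam) = 0 := fun x => by ring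
  simp only [h4, intervalIntegral.integral_zero, vartheta_zero hq, vartheta'_zero hq,
    varphi_zero hq, varphi'_zero hq] at h3
  linear_combination h3

variable {lam} in
-- If `φ(1) = 0`, then `φ` is a Dirichlet eigenfunction unless it vanishes on all of `[0,1]`. In
-- that case `φ'` vanishes almost everywhere, hence everywhere on `[0,1]` by continuity, against
-- `φ'(0) = 1`.
lemma varphi_one_ne_zero (h : lam ∉ dirichletSpectrum q) : varphi q 1 lam ≠ 0 := by
  intro h1
  have hphi := isODESolution_varphi hq lam
  refine h ⟨_, _, hphi, varphi_zero hq lam, h1, ?_⟩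
  by_contra! h0
  have hz : (fun t => varphi q t lam) =ᵐ[unitMeasure] 0 :=
    (ae_restrict_iff' measurableSet_Icc).2 (Filter.Eventually.of_forall h0)
  have hd : HasMagDeriv (fun _ => 0) (fun t => varphi q t lam) (fun t => varphi' q t lam) := by
    simpa [HasMagDeriv] using hphi.1
  have := Measure.eqOn_Icc_of_ae_eq volume zero_ne_one (hd.ae_eq_zero hz) hphi.2.continuousOn
    continuousOn_const (show (0 : ℝ) ∈ Set.Icc (0 : ℝ) 1 by simp)
  exact one_ne_zero ((varphi'_zero hq lam).symm.trans this)

omit lam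

lemma differentiable_vartheta {t : ℝ} (ht : t ∈ Set.Icc (0 : ℝ) 1) :
    Differentiable ℂ (vartheta q t) := (differentiable_ivpSolution hq 1 0 ht).1

lemma differentiable_vartheta' {t : ℝ} (ht : t ∈ Set.Icc (0 : ℝ) 1) :
    Differentiable ℂ (vartheta' q t) := (differentiable_ivpSolution hq 1 0 ht).2

lemma differentiable_varphi {t : ℝ} (ht : t ∈ Set.Icc (0 : ℝ) 1) :
    Differentiable ℂ (varphi q t) := (differentiable_ivpSolution hq 0 1 ht).1

lemma differentiable_varphi' {t : ℝ} (ht : t ∈ Set.Icc (0 : ℝ) 1) :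
    Differentiable ℂ (varphi' q t) := (differentiable_ivpSolution hq 0 1 ht).2

end Fundamental

/-! ### Functions that are meromorphic on the plane and analytic off a set -/

/-- `h` is meromorphic in the plane and analytic outside `S`. -/
def IsRegularOff (S : Set ℂ) (h : ℂ → ℂ) : Prop :=
  MeromorphicOn h Set.univ ∧ AnalyticOnNhd ℂ h Sᶜ

namespace IsRegularOff

variable {S : Set ℂ} {f g : ℂ → ℂ}

lemma of_differentiable (h : Differentiable ℂ f) : IsRegularOff S f :=
  ⟨fun x _ => (h.analyticAt x).meromorphicAt, fun x _ => h.analyticAt x⟩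

lemma const (c : ℂ) : IsRegularOff S fun _ => c := of_differentiable (differentiable_const c)

lemma add (hf : IsRegularOff S f) (hg : IsRegularOff S g) :
    IsRegularOff S fun x => f x + g x :=
  ⟨fun x hx => (hf.1 x hx).add (hg.1 x hx), fun x hx => (hf.2 x hx).add (hg.2 x hx)⟩

lemma mul (hf : IsRegularOff S f) (hg : IsRegularOff S g) :
    IsRegularOff S fun x => f x * g x :=
  ⟨fun x hx => (hf.1 x hx).mul (hg.1 x hx), fun x hx => (hf.2 x hx).mul (hg.2 x hx)⟩

lemma sub (hf : IsRegularOff S f) (hg : IsRegularOff S g) :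
    IsRegularOff S fun x => f x - g x :=
  ⟨fun x hx => (hf.1 x hx).sub (hg.1 x hx), fun x hx => (hf.2 x hx).sub (hg.2 x hx)⟩

lemma neg (hf : IsRegularOff S f) : IsRegularOff S fun x => -f x :=
  ⟨fun x hx => (hf.1 x hx).neg, fun x hx => (hf.2 x hx).neg⟩

lemma inv (hf : IsRegularOff S f) (h0 : ∀ x ∉ S, f x ≠ 0) : IsRegularOff S fun x => (f x)⁻¹ :=
  ⟨fun x hx => (hf.1 x hx).inv, fun x hx => (hf.2 x hx).inv (h0 x hx)⟩

lemma div (hf : IsRegularOff S f) (hg : IsRegularOff S g) (h0 : ∀ x ∉ S, g x ≠ 0) :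
    IsRegularOff S fun x => f x / g x := by
  simpa only [div_eq_mul_inv] using hf.mul (hg.inv h0)

end IsRegularOff

/-- All entries of the matrix function `A` are regular off `S`. -/
def IsMatrixRegularOff (S : Set ℂ) (A : ℂ → Matrix (Fin 2) (Fin 2) ℂ) : Prop :=
  ∀ i j, IsRegularOff S fun x => A x i j

namespace IsMatrixRegularOff

variable {S : Set ℂ} {A B : ℂ → Matrix (Fin 2) (Fin 2) ℂ}

lemma of_entries {a b c d : ℂ → ℂ} (ha : IsRegularOff S a) (hb : IsRegularOff S b)
    (hc : IsRegularOff S c) (hd : IsRegularOff S d) :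
    IsMatrixRegularOff S fun x => !![a x, b x; c x, d x] := by
  intro i j
  fin_cases i <;> fin_cases j
  exacts [ha, hb, hc, hd]

lemma mul (hA : IsMatrixRegularOff S A) (hB : IsMatrixRegularOff S B) :
    IsMatrixRegularOff S fun x => A x * B x := by
  intro i j
  simp only [Matrix.mul_apply, Fin.sum_univ_two]
  exact ((hA i 0).mul (hB 0 j)).add ((hA i 1).mul (hB 1 j))

lemma smul {f : ℂ → ℂ} (hf : IsRegularOff S f) (hA : IsMatrixRegularOff S A) :
    IsMatrixRegularOff S fun x => f x • A x :=
  fun i j => hf.mul (hA i j)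

/-- The adjugate formula leaves the determinant as the only denominator. -/
lemma inv (hA : IsMatrixRegularOff S A) (h0 : ∀ x ∉ S, (A x).det ≠ 0) :
    IsMatrixRegularOff S fun x => (A x)⁻¹ := by
  simp only [Matrix.inv_def, Ring.inverse_eq_inv', Matrix.adjugate_fin_two]
  refine smul (IsRegularOff.inv ?_ h0) (of_entries (hA 1 1) (hA 0 1).neg (hA 1 0).neg (hA 0 0))
  simp only [Matrix.det_fin_two]
  exact ((hA 0 0).mul (hA 1 1)).sub ((hA 0 1).mul (hA 1 0))

lemma pow (hA : IsMatrixRegularOff S A) (n : ℕ) : IsMatrixRegularOff S fun x => A x ^ n := by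
  induction n with
  | zero =>
    intro i j
    simpa only [pow_zero] using IsRegularOff.const _
  | succ n ih => simpa only [pow_succ] using ih.mul hA

lemma zpow (hA : IsMatrixRegularOff S A) (h0 : ∀ x ∉ S, (A x).det ≠ 0) (n : ℤ) :
    IsMatrixRegularOff S fun x => A x ^ n := by
  cases n with
  | ofNat n => simpa only [Int.ofNat_eq_natCast, zpow_natCast] using hA.pow n
  | negSucc n =>
    simp only [zpow_negSucc]
    refine (hA.pow _).inv fun x hx => ?_
    rw [Matrix.det_pow]
    exact pow_ne_zero _ (h0 x hx)

lemma mulVec (hA : IsMatrixRegularOff S A) (v : Fin 2 → ℂ) (i : Fin 2) :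
    IsRegularOff S fun x => (A x).mulVec v i := by
  simp only [Matrix.mulVec, dotProduct, Fin.sum_univ_two]
  exact ((hA i 0).mul (.const _)).add ((hA i 1).mul (.const _))

end IsMatrixRegularOff

/-! ### The transfer matrix across one cell of `Γ^(1)` -/

lemma sPow_ne_zero (N : ℕ) (k : ℤ) : sPow N k ≠ 0 := exp_ne_zero _

lemma sNegHalfPow_ne_zero (N : ℕ) (k : ℤ) : sNegHalfPow N k ≠ 0 := exp_ne_zero _

lemma sNegHalfPow_sq_mul_sPow (N : ℕ) (k : ℤ) : sNegHalfPow N k ^ 2 * sPow N k = 1 := by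
  rw [sNegHalfPow, sPow, ← exp_nat_mul, ← exp_add, ← exp_zero]
  congr 1
  push_cast
  ring

lemma sPow_neg (N : ℕ) (k : ℤ) : sPow N (-k) = sNegHalfPow N k ^ 2 := by
  rw [sNegHalfPow, sPow, ← exp_nat_mul]
  congr 1
  push_cast
  ring

/-- Source of `c_k`: the phases along the two parallel edges of a cell add up, and factoring out the
mean phase leaves a cosine. -/
lemma sNegHalfPow_mul_one_add (N : ℕ) (a : ℝ) (k : ℤ) :
    sNegHalfPow N k * (1 + exp (I * a) ^ 2 * sPow N k) = 2 * cCoef N a k * exp (I * a) := by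
  have h : (cCoef N a k : ℂ) = (exp ((a + Real.pi * k / N) * I) +
      exp (-(a + Real.pi * k / N) * I)) / 2 := by
    rw [cCoef, ofReal_cos, Complex.cos]
    push_cast
    rfl
  rw [h, sNegHalfPow, sPow, mul_div_cancel₀ _ two_ne_zero, mul_add, add_mul, add_comm,
    ← exp_nat_mul, ← exp_add, ← exp_add, ← exp_add, ← exp_add, mul_one]
  congr 1 <;> congr 1 <;> push_cast <;> ring

/-- The matrix `R⁻¹ T_k R M` that takes the data at the start of the edge `(n, 0)` to those at the
start of the edge `(n + 1, 0)`. -/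
def cellMatrix (N : ℕ) (a : ℝ) (q : ℝ → ℝ) (k : ℤ) (lam : ℂ) : Matrix (Fin 2) (Fin 2) ℂ :=
  (scalingMatrix q lam)⁻¹ * transferMatrix N a q k lam * scalingMatrix q lam *
    scalarMonodromy q lam

lemma scalingMatrix_inv {q : ℝ → ℝ} {lam : ℂ} (h : varphi q 1 lam ≠ 0) :
    (scalingMatrix q lam)⁻¹ = !![1, 0; 0, (varphi q 1 lam)⁻¹] := by
  refine Matrix.inv_eq_right_inv ?_
  simp [scalingMatrix, h, Matrix.one_fin_two]

/-- Written out, `φ(1)` survives as a denominator only in the lower left entry, so it does not enter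
the trace. -/
lemma cellMatrix_eq (N : ℕ) (a : ℝ) {q : ℝ → ℝ} (k : ℤ) {lam : ℂ} (h : varphi q 1 lam ≠ 0) :
    cellMatrix N a q k lam = (sNegHalfPow N k / (2 * (cCoef N a k : ℂ))) •
      !![2 * lyapunov q lam * vartheta q 1 lam + varphi q 1 lam * vartheta' q 1 lam,
        2 * lyapunov q lam * varphi q 1 lam + varphi q 1 lam * varphi' q 1 lam;
        (4 * lyapunov q lam ^ 2 - 4 * (cCoef N a k : ℂ) ^ 2) * vartheta q 1 lam / varphi q 1 lam +
          2 * lyapunov q lam * vartheta' q 1 lam,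
        4 * lyapunov q lam ^ 2 - 4 * (cCoef N a k : ℂ) ^ 2 +
          2 * lyapunov q lam * varphi' q 1 lam] := by
  rw [cellMatrix, scalingMatrix_inv h, transferMatrix, scalingMatrix, scalarMonodromy,
    Matrix.mul_smul, Matrix.smul_mul, Matrix.smul_mul]
  congr 1
  ext i j
  fin_cases i <;> fin_cases j <;> simp <;> field_simp

section Cell

variable {N : ℕ} {a : ℝ} {q : ℝ → ℝ} {k : ℤ} {lam : ℂ}

/-- Conjugation by `R` does not change the determinant, the Wronskian gives `det M = 1`, and in `det
T_k` the terms in `Δ²` cancel. -/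
lemma det_cellMatrix (hq : IntervalIntegrable q volume 0 1) (hc : cCoef N a k ≠ 0)
    (h : varphi q 1 lam ≠ 0) : (cellMatrix N a q k lam).det = sPow N (-k) := by
  have hc' : (cCoef N a k : ℂ) ≠ 0 := ofReal_ne_zero.2 hc
  have hw := wronskian_eq_one hq lam (t := 1) (by simp)
  have hM : (scalarMonodromy q lam).det = 1 := by
    rw [scalarMonodromy, Matrix.det_fin_two_of]
    linear_combination hw
  have hT : (transferMatrix N a q k lam).det = sPow N (-k) := by
    rw [transferMatrix, Matrix.det_smul, Matrix.det_fin_two_of, sPow_neg, Fintype.card_fin]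
    field_simp
    ring
  have hR : (scalingMatrix q lam)⁻¹.det * (scalingMatrix q lam).det = 1 := by
    rw [scalingMatrix_inv h, scalingMatrix, Matrix.det_fin_two_of, Matrix.det_fin_two_of]
    simp [h]
  rw [cellMatrix, Matrix.det_mul, Matrix.det_mul, Matrix.det_mul, hM, hT]
  linear_combination sPow N (-k) * hR

/-- The diagonal entries add up to `8Δ² + φϑ' - 4c_k² = 4(F + s_k²)`, once `ϑ + φ'` is recognised as
`2Δ`. -/
lemma trace_cellMatrix (hc : cCoef N a k ≠ 0) (h : varphi q 1 lam ≠ 0) :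
    (cellMatrix N a q k lam).trace =
      2 * sNegHalfPow N k * (lyapunovF q lam + (sCoef N a k : ℂ) ^ 2) / (cCoef N a k : ℂ) := by
  have hc' : (cCoef N a k : ℂ) ≠ 0 := ofReal_ne_zero.2 hc
  have hcs : (sCoef N a k : ℂ) ^ 2 = 1 - (cCoef N a k : ℂ) ^ 2 := by
    rw [sCoef, cCoef, ← ofReal_pow, Real.sin_sq]
    push_cast
    rfl
  rw [cellMatrix_eq N a k h, Matrix.trace_smul, Matrix.trace_fin_two_of, hcs, lyapunovF]
  have hl : vartheta q 1 lam = 2 * lyapunov q lam - varphi' q 1 lam := by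
    rw [lyapunov]
    ring
  rw [hl, smul_eq_mul]
  field_simp
  ring

lemma det_cellMatrix_ne_zero (hq : IntervalIntegrable q volume 0 1) (hc : cCoef N a k ≠ 0)
    (h : lam ∉ dirichletSpectrum q) : (cellMatrix N a q k lam).det ≠ 0 := by
  rw [det_cellMatrix hq hc (varphi_one_ne_zero hq h)]
  exact sPow_ne_zero _ _

lemma isMatrixRegularOff_cellMatrix (hq : IntervalIntegrable q volume 0 1) :
    IsMatrixRegularOff (dirichletSpectrum q) (cellMatrix N a q k) := by
  have h1 : (1 : ℝ) ∈ Set.Icc (0 : ℝ) 1 := by simp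
  have t1 := differentiable_vartheta hq h1
  have t2 := differentiable_vartheta' hq h1
  have t3 := differentiable_varphi hq h1
  have t4 := differentiable_varphi' hq h1
  have tl : Differentiable ℂ (lyapunov q) := (t4.add t1).div_const 2
  have hR : IsMatrixRegularOff (dirichletSpectrum q) (scalingMatrix q) :=
    .of_entries (.const _) (.const _) (.const _) (.of_differentiable t3)
  refine IsMatrixRegularOff.mul (.mul (.mul (hR.inv fun lam h => ?_) ?_) hR) ?_
  · simpa [scalingMatrix] using varphi_one_ne_zero hq h
  · refine .smul (.const _) (.of_entries ?_ ?_ ?_ ?_) <;>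
      exact .of_differentiable (by fun_prop)
  · exact .of_entries (.of_differentiable t1) (.of_differentiable t3) (.of_differentiable t2)
      (.of_differentiable t4)

/-- For prescribed values `X`, `Z` at the two vertices joined by the edges `(n, 1)`, `(n, 2)`, the
Kirchhoff conditions on the derivatives determine `Z` and the derivative `W` at the start of the
next vertical edge from `X` and the derivative `d` at the end of the previous one. -/
lemma kirchhoff_iff_transfer (hq : IntervalIntegrable q volume 0 1) (hc : cCoef N a k ≠ 0)
    (h : varphi q 1 lam ≠ 0) (u w Z W : ℂ) :
    (-solutionOf' q lam (u, w) 1 +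
          (exp (-(I * a)) * Z - vartheta q 1 lam * solutionOf q lam (u, w) 1) / varphi q 1 lam -
        (varphi' q 1 lam * solutionOf q lam (u, w) 1 - exp (I * a) * sPow N k * Z) /
          varphi q 1 lam = 0 ∧
      W - (varphi' q 1 lam * Z - exp (I * a) * solutionOf q lam (u, w) 1) / varphi q 1 lam +
        ((exp (I * a) * sPow N k)⁻¹ * solutionOf q lam (u, w) 1 - vartheta q 1 lam * Z) /
          varphi q 1 lam = 0) ↔
    ![Z, W] = (cellMatrix N a q k lam).mulVec ![u, w] := by
  have hc' : (cCoef N a k : ℂ) ≠ 0 := ofReal_ne_zero.2 hc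
  have hw := wronskian_eq_one hq lam (t := 1) (by simp)
  have hp : exp (I * a) ≠ 0 := exp_ne_zero _
  have hs := sPow_ne_zero N k
  have hh := sNegHalfPow_ne_zero N k
  have e1 := sNegHalfPow_sq_mul_sPow N k
  have e2 := sNegHalfPow_mul_one_add N a k
  rw [cellMatrix_eq N a k h, exp_neg]
  have hX : solutionOf q lam (u, w) 1 = u * vartheta q 1 lam + w * varphi q 1 lam := rfl
  have hd : solutionOf' q lam (u, w) 1 = u * vartheta' q 1 lam + w * varphi' q 1 lam := rfl
  have hl : 2 * lyapunov q lam = vartheta q 1 lam + varphi' q 1 lam := by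
    rw [lyapunov]
    ring
  have hl2 : 4 * lyapunov q lam ^ 2 = (vartheta q 1 lam + varphi' q 1 lam) ^ 2 := by
    rw [← hl]
    ring
  rw [hl, hl2]
  -- From here on the claim is algebra in independent letters, tied only by the recorded relations.
  generalize solutionOf q lam (u, w) 1 = X at *
  generalize solutionOf' q lam (u, w) 1 = d at *
  generalize exp (I * a) = p at *
  generalize sPow N k = σ at *
  generalize sNegHalfPow N k = s at *
  generalize (cCoef N a k : ℂ) = c at *
  generalize vartheta q 1 lam = A at *
  generalize vartheta' q 1 lam = A' at *
  generalize varphi q 1 lam = B at *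
  generalize varphi' q 1 lam = B' at *
  -- Here `p⁻¹ + pσ` is the coefficient of `Z` in the first condition (up to the factor `1/B`); it
  -- is nonzero exactly because `c ≠ 0`.
  have e3 : s * (p⁻¹ + p * σ) = 2 * c := by
    field_simp
    linear_combination e2
  -- Likewise `p + (pσ)⁻¹` is the coefficient of `X` in the second condition, up to the factor
  -- `1/B`.
  have e4 : p + (p * σ)⁻¹ = 2 * c * s := by
    field_simp
    linear_combination s * σ * e2 - (1 + p ^ 2 * σ) * e1
  have k1 : -d + (p⁻¹ * Z - A * X) / B - (B' * X - p * σ * Z) / B = 0 ↔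
      Z = s / (2 * c) * ((A + B') * X + B * d) := by
    have : -d + (p⁻¹ * Z - A * X) / B - (B' * X - p * σ * Z) / B =
        2 * c / (s * B) * (Z - s / (2 * c) * ((A + B') * X + B * d)) := by
      rw [← e3]
      have : s * (p⁻¹ + p * σ) ≠ 0 := by
        rw [e3]
        exact mul_ne_zero two_ne_zero hc'
      have : p⁻¹ + p * σ ≠ 0 := right_ne_zero_of_mul this
      generalize p⁻¹ = r at *
      field_simp
      ring
    rw [this, mul_eq_zero, sub_eq_zero]
    exact or_iff_right (div_ne_zero (mul_ne_zero two_ne_zero hc') (mul_ne_zero hh h))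
  have k2 : W - (B' * Z - p * X) / B + ((p * σ)⁻¹ * X - A * Z) / B = 0 ↔
      W = ((A + B') * Z - 2 * c * s * X) / B := by
    rw [← e4, ← sub_eq_zero (a := W)]
    refine Eq.congr_left ?_
    ring
  -- The second condition gives `W` in terms of `X` and `Z`; it is rewritten with `Z` eliminated by
  -- means of the first, so as to match the second row of the matrix.
  rw [k1, k2, and_congr_right (b := W = _) (c := W = s / (2 * c) *
    (((A + B') ^ 2 - 4 * c ^ 2) / B * X + (A + B') * d))]
  · rw [hX, hd, Matrix.smul_mulVec, funext_iff, Fin.forall_fin_two]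
    refine and_congr (Eq.congr_right ?_) (Eq.congr_right ?_)
    · simp only [Pi.smul_apply, smul_eq_mul, Matrix.mulVec, dotProduct,
        Fin.sum_univ_two, Matrix.of_apply, Matrix.cons_val_zero, Matrix.cons_val_one]
      ring
    · simp only [Pi.smul_apply, smul_eq_mul, Matrix.mulVec, dotProduct,
        Fin.sum_univ_two, Matrix.of_apply, Matrix.cons_val_zero, Matrix.cons_val_one]
      field_simp
      ring
  · intro hZ
    refine Eq.congr_right ?_
    rw [hZ]
    field_simp
    ring

end Cell

/-! ### Solutions on `Γ^(1)` -/

/-- The initial data of the solution of `-y'' + q y = lam y` with `y(0) = y₀`, `y(1) = y₁`. -/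
def dirichletData (q : ℝ → ℝ) (lam y₀ y₁ : ℂ) : ℂ × ℂ :=
  (y₀, (y₁ - vartheta q 1 lam * y₀) / varphi q 1 lam)

section GraphSolution

variable {N : ℕ} {a : ℝ} {q : ℝ → ℝ} {k : ℤ} {lam : ℂ}

lemma eq_dirichletData_iff (h : varphi q 1 lam ≠ 0) {c : ℂ × ℂ} {y₀ y₁ : ℂ} :
    c = dirichletData q lam y₀ y₁ ↔ c.1 = y₀ ∧ solutionOf q lam c 1 = y₁ := by
  rw [Prod.ext_iff]
  refine and_congr_right fun h0 => ?_
  replace h0 : c.1 = y₀ := h0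
  rw [dirichletData, solutionOf, h0, eq_div_iff h, eq_sub_iff_add_eq']
  refine Eq.congr_left ?_
  ring

/-- The terms in `y₀` combine to minus the Wronskian. -/
lemma solutionOf'_dirichletData_one (hq : IntervalIntegrable q volume 0 1)
    (h : varphi q 1 lam ≠ 0) (y₀ y₁ : ℂ) :
    solutionOf' q lam (dirichletData q lam y₀ y₁) 1 =
      (varphi' q 1 lam * y₁ - y₀) / varphi q 1 lam := by
  have hw := wronskian_eq_one hq lam (t := 1) (by simp)
  rw [solutionOf', dirichletData]
  field_simp
  linear_combination -y₀ * hw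

/-- The family of solutions on the edges with initial data `c` satisfies the twisted Kirchhoff
conditions iff its data on the edges `(n, 0)` are propagated by the cell matrix and those on the
other edges are determined by the values at the vertices. -/
lemma endpoints_mem_twistedKirchhoff_iff (hq : IntervalIntegrable q volume 0 1)
    (hc : cCoef N a k ≠ 0) (h : varphi q 1 lam ≠ 0) (c : Edge₁ → ℂ × ℂ) :
    (endpoints fun ω => solutionOf q lam (c ω), endpoints fun ω => solutionOf' q lam (c ω)) ∈
        twistedKirchhoff N a k ↔
      ∀ n : ℤ,
        ![(c (n + 1, 0)).1, (c (n + 1, 0)).2] =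
          (cellMatrix N a q k lam).mulVec ![(c (n, 0)).1, (c (n, 0)).2] ∧
        c (n, 1) = dirichletData q lam (solutionOf q lam (c (n, 0)) 1)
          (exp (-(I * a)) * (c (n + 1, 0)).1) ∧
        c (n, 2) = dirichletData q lam (c (n + 1, 0)).1
          ((exp (I * a) * sPow N k)⁻¹ * solutionOf q lam (c (n, 0)) 1) := by
  refine forall_congr' fun n => ?_
  have hp : exp (I * a) ≠ 0 := exp_ne_zero _
  have hs := sPow_ne_zero N k
  have hT := kirchhoff_iff_transfer hq hc h (c (n, 0)).1 (c (n, 0)).2 (c (n + 1, 0)).1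
    (c (n + 1, 0)).2
  simp only [endpoints, Matrix.cons_val_zero, Matrix.cons_val_one, solutionOf_zero hq,
    solutionOf'_zero hq]
  -- The four continuity conditions alone say that the edges `(n,1)` and `(n,2)` carry the solutions
  -- of Dirichlet problems with the vertex values; the derivative conditions are then left for
  -- `kirchhoff_iff_transfer`.
  have hdir : ((solutionOf q lam (c (n, 0)) 1 = (c (n, 1)).1 ∧
      (c (n, 1)).1 = exp (I * a) * sPow N k * solutionOf q lam (c (n, 2)) 1) ∧
      ((c (n + 1, 0)).1 = exp (I * a) * solutionOf q lam (c (n, 1)) 1 ∧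
        exp (I * a) * solutionOf q lam (c (n, 1)) 1 = (c (n, 2)).1)) ↔
      (c (n, 1) = dirichletData q lam (solutionOf q lam (c (n, 0)) 1)
          (exp (-(I * a)) * (c (n + 1, 0)).1) ∧
        c (n, 2) = dirichletData q lam (c (n + 1, 0)).1
          ((exp (I * a) * sPow N k)⁻¹ * solutionOf q lam (c (n, 0)) 1)) := by
    rw [eq_dirichletData_iff h, eq_dirichletData_iff h, exp_neg, eq_inv_mul_iff_mul_eq₀ hp,
      eq_inv_mul_iff_mul_eq₀ (mul_ne_zero hp hs)]
    grind
  rw [← and_assoc, hdir, and_comm]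
  refine and_congr_left fun hd => ?_
  rw [hd.1, hd.2, solutionOf'_dirichletData_one hq h, solutionOf'_dirichletData_one hq h, ← hT]
  refine and_congr (Eq.congr_left ?_) (Eq.congr_left ?_)
  · simp only [dirichletData]
    field_simp
  · simp only [dirichletData, exp_neg]
    field_simp

/-- The data at the starts of the edges of the solution on `Γ^(1)` with data `v` on `(0, 0)`. -/
def graphData (N : ℕ) (a : ℝ) (q : ℝ → ℝ) (k : ℤ) (v : Fin 2 → ℂ) (lam : ℂ) (ω : Edge₁) : ℂ × ℂ :=
  let S (n : ℤ) : Fin 2 → ℂ := (cellMatrix N a q k lam ^ n).mulVec v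
  let X := solutionOf q lam (S ω.1 0, S ω.1 1) 1
  let Z := S (ω.1 + 1) 0
  if ω.2 = 0 then (S ω.1 0, S ω.1 1)
  else if ω.2 = 1 then dirichletData q lam X (exp (-(I * a)) * Z)
  else dirichletData q lam Z ((exp (I * a) * sPow N k)⁻¹ * X)

/-- Existence and uniqueness at once: a first order recursion on `ℤ` with invertible matrix is
solved only by the powers of that matrix, and the other edges follow from the vertical ones. -/
lemma eq_graphData_iff (hq : IntervalIntegrable q volume 0 1) (hc : cCoef N a k ≠ 0)
    (h : lam ∉ dirichletSpectrum q) (c : Edge₁ → ℂ × ℂ) (v : Fin 2 → ℂ) :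
    c = graphData N a q k v lam ↔
      (endpoints fun ω => solutionOf q lam (c ω), endpoints fun ω => solutionOf' q lam (c ω)) ∈
        twistedKirchhoff N a k ∧ c (0, 0) = (v 0, v 1) := by
  have hphi := varphi_one_ne_zero hq h
  have hdet : IsUnit (cellMatrix N a q k lam).det := (det_cellMatrix_ne_zero hq hc h).isUnit
  rw [endpoints_mem_twistedKirchhoff_iff hq hc hphi]
  have hvec (w : Fin 2 → ℂ) : ![w 0, w 1] = w := by
    ext i
    fin_cases i <;> rfl
  constructor
  · rintro rfl
    refine ⟨fun n => ⟨?_, ?_, ?_⟩, ?_⟩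
    · simp only [graphData, if_true, hvec]
      rw [Matrix.mulVec_mulVec, add_comm n, Matrix.zpow_one_add hdet]
    · simp [graphData]
    · simp [graphData, show (2 : ZMod 3) ≠ 0 by decide, show (2 : ZMod 3) ≠ 1 by decide]
    · simp [graphData]
  · rintro ⟨hn, h0⟩
    have key (n : ℤ) : ![(c (n, 0)).1, (c (n, 0)).2] = (cellMatrix N a q k lam ^ n).mulVec v := by
      induction n with
      | zero => simp [h0, hvec]
      | succ n ih =>
        rw [(hn n).1, ih, Matrix.mulVec_mulVec, add_comm, Matrix.zpow_one_add hdet]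
      -- Going to the left inverts the recursion, which is where the nonvanishing determinant is
      -- needed for uniqueness.
      | pred n ih =>
        have h1 := (hn (-n - 1)).1
        rw [sub_add_cancel, ih] at h1
        rw [sub_eq_neg_add, Matrix.zpow_add hdet, ← Matrix.mulVec_mulVec, neg_add_eq_sub, h1,
          Matrix.mulVec_mulVec, zpow_neg_one, Matrix.nonsing_inv_mul _ hdet, Matrix.one_mulVec]
    have key0 (n : ℤ) : (cellMatrix N a q k lam ^ n).mulVec v 0 = (c (n, 0)).1 := by
      rw [← key]
      rfl
    have key1 (n : ℤ) : (cellMatrix N a q k lam ^ n).mulVec v 1 = (c (n, 0)).2 := by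
      rw [← key]
      rfl
    funext ⟨n, j⟩
    simp only [graphData, key0, key1]
    fin_cases j
    · rfl
    · exact (hn n).2.1
    · exact (hn n).2.2

lemma isUniqueGraphSolution_graphData (hq : IntervalIntegrable q volume 0 1)
    (hc : cCoef N a k ≠ 0) (h : lam ∉ dirichletSpectrum q) (c₀ c₁ : ℂ) :
    IsUniqueGraphSolution N a q k lam c₀ c₁
      (fun ω => solutionOf q lam (graphData N a q k ![c₀, c₁] lam ω))
      (fun ω => solutionOf' q lam (graphData N a q k ![c₀, c₁] lam ω)) := by
  obtain ⟨h1, h2⟩ := (eq_graphData_iff hq hc h _ ![c₀, c₁]).1 rfl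
  refine ⟨⟨fun ω => isODESolution_solutionOf hq lam _, h1⟩, ?_, ?_, ?_⟩
  · simp [solutionOf_zero hq, h2]
  · simp [solutionOf'_zero hq, h2]
  · rintro g dg ⟨hg, hK⟩ g0 dg0 ω t ht
    have hgs (ω : Edge₁) {t : ℝ} (ht : t ∈ Set.Icc (0 : ℝ) 1) := (hg ω).eq_solutionOf hq ht
    -- On each edge `g` is determined by its data at `0`, so it suffices to compare these data with
    -- `graphData`.
    have hd : (fun ω => (g ω 0, dg ω 0)) = graphData N a q k ![c₀, c₁] lam := by
      rw [eq_graphData_iff hq hc h]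
      refine ⟨?_, by simp [g0, dg0]⟩
      convert hK using 2
      · funext ω i
        fin_cases i
        · exact (hgs ω (by simp)).1.symm
        · exact (hgs ω (by simp)).1.symm
      · funext ω i
        fin_cases i
        · exact (hgs ω (by simp)).2.symm
        · exact (hgs ω (by simp)).2.symm
    rw [← hd]
    exact hgs ω ht

/-- The data consist of integer powers of the cell matrix, whose determinant does not vanish off
`σ_D`, and of Dirichlet data, whose only denominator is `φ(1)`. -/
lemma isRegularOff_graphData (hq : IntervalIntegrable q volume 0 1) (hc : cCoef N a k ≠ 0)
    (v : Fin 2 → ℂ) (ω : Edge₁) :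
    IsRegularOff (dirichletSpectrum q) (fun lam => (graphData N a q k v lam ω).1) ∧
      IsRegularOff (dirichletSpectrum q) (fun lam => (graphData N a q k v lam ω).2) := by
  obtain ⟨n, j⟩ := ω
  have h1 : (1 : ℝ) ∈ Set.Icc (0 : ℝ) 1 := by simp
  have ht : IsRegularOff (dirichletSpectrum q) (vartheta q 1) :=
    .of_differentiable (differentiable_vartheta hq h1)
  have hp : IsRegularOff (dirichletSpectrum q) (varphi q 1) :=
    .of_differentiable (differentiable_varphi hq h1)
  have hS (n : ℤ) (i : Fin 2) : IsRegularOff (dirichletSpectrum q)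
      fun lam => (cellMatrix N a q k lam ^ n).mulVec v i :=
    ((isMatrixRegularOff_cellMatrix hq).zpow
      (fun lam h => det_cellMatrix_ne_zero hq hc h) n).mulVec v i
  have hX : IsRegularOff (dirichletSpectrum q) fun lam => solutionOf q lam
      ((cellMatrix N a q k lam ^ n).mulVec v 0, (cellMatrix N a q k lam ^ n).mulVec v 1) 1 :=
    ((hS n 0).mul ht).add ((hS n 1).mul hp)
  have hD {y₀ y₁ : ℂ → ℂ} (h₀ : IsRegularOff (dirichletSpectrum q) y₀)
      (h₁ : IsRegularOff (dirichletSpectrum q) y₁) : IsRegularOff (dirichletSpectrum q)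
      (fun lam => (dirichletData q lam (y₀ lam) (y₁ lam)).2) :=
    (h₁.sub (ht.mul h₀)).div hp fun lam h => varphi_one_ne_zero hq h
  have hZ := hS (n + 1) 0
  fin_cases j
  · exact ⟨hS n 0, hS n 1⟩
  · exact ⟨hX, hD hX ((IsRegularOff.const _).mul hZ)⟩
  · exact ⟨hZ, hD hZ ((IsRegularOff.const _).mul hX)⟩

lemma isRegularOff_solutionOf_graphData (hq : IntervalIntegrable q volume 0 1)
    (hc : cCoef N a k ≠ 0) (v : Fin 2 → ℂ) (ω : Edge₁) {t : ℝ} (ht : t ∈ Set.Icc (0 : ℝ) 1) :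
    IsRegularOff (dirichletSpectrum q)
      (fun lam => solutionOf q lam (graphData N a q k v lam ω) t) :=
  ((isRegularOff_graphData hq hc v ω).1.mul (.of_differentiable (differentiable_vartheta hq ht))).add
    ((isRegularOff_graphData hq hc v ω).2.mul (.of_differentiable (differentiable_varphi hq ht)))

lemma graphMonodromy_graphData (hq : IntervalIntegrable q volume 0 1) :
    graphMonodromy (fun ω => solutionOf q lam (graphData N a q k ![1, 0] lam ω))
      (fun ω => solutionOf' q lam (graphData N a q k ![1, 0] lam ω))
      (fun ω => solutionOf q lam (graphData N a q k ![0, 1] lam ω))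
      (fun ω => solutionOf' q lam (graphData N a q k ![0, 1] lam ω)) =
    cellMatrix N a q k lam := by
  ext i j
  fin_cases i <;> fin_cases j <;>
    simp [graphMonodromy, solutionOf_zero hq, solutionOf'_zero hq, graphData]

lemma differentiable_lyapunovF (hq : IntervalIntegrable q volume 0 1) :
    Differentiable ℂ (lyapunovF q) := by
  have h1 : (1 : ℝ) ∈ Set.Icc (0 : ℝ) 1 := by simp
  have t1 := differentiable_vartheta hq h1
  have t2 := differentiable_vartheta' hq h1
  have t3 := differentiable_varphi hq h1
  have t4 := differentiable_varphi' hq h1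
  have tl : Differentiable ℂ (lyapunov q) := (t4.add t1).div_const 2
  exact (((tl.pow 2).const_mul 2).add ((t3.mul t2).div_const 4)).sub_const 1

lemma det_cellMatrix_sub (hq : IntervalIntegrable q volume 0 1) (hc : cCoef N a k ≠ 0)
    (h : lam ∉ dirichletSpectrum q) (τ : ℂ) :
    (cellMatrix N a q k lam - τ • (1 : Matrix (Fin 2) (Fin 2) ℂ)).det =
      τ ^ 2 - τ * (2 * sNegHalfPow N k * (lyapunovF q lam + (sCoef N a k : ℂ) ^ 2) /
        (cCoef N a k : ℂ)) + sPow N (-k) := by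
  have hphi := varphi_one_ne_zero hq h
  rw [← det_cellMatrix hq hc hphi, ← trace_cellMatrix hc hphi]
  simp [Matrix.det_fin_two, Matrix.trace_fin_two]
  ring

end GraphSolution

theorem exists_fundamental_graph_solutions (N : ℕ) {q : ℝ → ℝ}
    (hq : IntervalIntegrable q volume 0 1) (a : ℝ) (k : ℤ) (hc : cCoef N a k ≠ 0) :
    ∃ Θ dΘ Φ dΦ : ℂ → Edge₁ → ℝ → ℂ,
      (∀ lam ∉ dirichletSpectrum q,
        IsUniqueGraphSolution N a q k lam 1 0 (Θ lam) (dΘ lam) ∧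
        IsUniqueGraphSolution N a q k lam 0 1 (Φ lam) (dΦ lam)) ∧
      (∀ ω, ∀ t ∈ Set.Icc (0 : ℝ) 1,
        MeromorphicOn (fun lam => Θ lam ω t) Set.univ ∧
        MeromorphicOn (fun lam => Φ lam ω t) Set.univ ∧
        AnalyticOnNhd ℂ (fun lam => Θ lam ω t) (dirichletSpectrum q)ᶜ ∧
        AnalyticOnNhd ℂ (fun lam => Φ lam ω t) (dirichletSpectrum q)ᶜ) ∧
      (∀ lam ∉ dirichletSpectrum q,
        graphMonodromy (Θ lam) (dΘ lam) (Φ lam) (dΦ lam) =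
            (scalingMatrix q lam)⁻¹ * transferMatrix N a q k lam * scalingMatrix q lam *
              scalarMonodromy q lam ∧
        (graphMonodromy (Θ lam) (dΘ lam) (Φ lam) (dΦ lam)).det = sPow N (-k) ∧
        (graphMonodromy (Θ lam) (dΘ lam) (Φ lam) (dΦ lam)).trace =
          2 * sNegHalfPow N k * (lyapunovF q lam + (sCoef N a k : ℂ) ^ 2) / (cCoef N a k : ℂ)) ∧
      ∃ D : ℂ × ℂ → ℂ, Differentiable ℂ D ∧
        ∀ τ : ℂ, ∀ lam ∉ dirichletSpectrum q,
          D (τ, lam) = (graphMonodromy (Θ lam) (dΘ lam) (Φ lam) (dΦ lam) -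
            τ • (1 : Matrix (Fin 2) (Fin 2) ℂ)).det := by
  refine ⟨fun lam ω => solutionOf q lam (graphData N a q k ![1, 0] lam ω),
    fun lam ω => solutionOf' q lam (graphData N a q k ![1, 0] lam ω),
    fun lam ω => solutionOf q lam (graphData N a q k ![0, 1] lam ω),
    fun lam ω => solutionOf' q lam (graphData N a q k ![0, 1] lam ω),
    fun lam h => ⟨isUniqueGraphSolution_graphData hq hc h 1 0,
      isUniqueGraphSolution_graphData hq hc h 0 1⟩,
    fun ω t ht => ?_, fun lam h => ?_, ?_⟩
  · have hΘ := isRegularOff_solutionOf_graphData hq hc ![1, 0] ω ht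
    have hΦ := isRegularOff_solutionOf_graphData hq hc ![0, 1] ω ht
    exact ⟨hΘ.1, hΦ.1, hΘ.2, hΦ.2⟩
  · have hphi := varphi_one_ne_zero hq h
    rw [graphMonodromy_graphData hq]
    exact ⟨rfl, det_cellMatrix hq hc hphi, trace_cellMatrix hc hphi⟩
  -- The extension is the characteristic polynomial with the trace and determinant formulas
  -- inserted; its coefficients involve only the entire function `F` and constants.
  · refine ⟨fun p => p.1 ^ 2 - p.1 * (2 * sNegHalfPow N k *
      (lyapunovF q p.2 + (sCoef N a k : ℂ) ^ 2) / (cCoef N a k : ℂ)) + sPow N (-k), ?_,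
      fun τ lam h => ?_⟩
    · simp only [div_eq_mul_inv]
      have hF : Differentiable ℂ fun p : ℂ × ℂ => lyapunovF q p.2 :=
        (differentiable_lyapunovF hq).comp differentiable_snd
      exact ((differentiable_fst.pow 2).sub (differentiable_fst.mul
        (((hF.add_const _).const_mul _).mul_const _))).add_const _
    · rw [graphMonodromy_graphData hq, det_cellMatrix_sub hq hc h]

/-! ### The vector potential along the edges of the tube -/

/-- The parameter `t` disappears because `𝒜` is linear and `𝒜(e)` is orthogonal to `e`. -/
lemma edgePotential_eq (N : ℕ) (B : ℝ) (ω : Edge N) (t : ℝ) :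
    edgePotential N B ω t = B / 2 * (edgeStart N ω 0 * edgeEnd N ω 1 -
      edgeStart N ω 1 * edgeEnd N ω 0) := by
  simp [edgePotential, vectorPotential, PiLp.inner_apply, Fin.sum_univ_three]
  ring

lemma tubePoint_cross (N : ℕ) (θ₀ θ₁ h₀ h₁ : ℝ) :
    tubePoint N θ₀ h₀ 0 * tubePoint N θ₁ h₁ 1 - tubePoint N θ₀ h₀ 1 * tubePoint N θ₁ h₁ 0 =
      tubeRadius N ^ 2 * Real.sin (θ₁ - θ₀) := by
  simp [tubePoint, Real.sin_sub]
  ring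

/-- The double angle formula cancels one factor `sin(π/2N)` of `R²`; `N ≥ 1` keeps that sine away
from zero. -/
lemma tubeFlux_eq (N : ℕ) [NeZero N] (B : ℝ) :
    B / 2 * (tubeRadius N ^ 2 * Real.sin (Real.pi / N)) = tubeFlux N B := by
  have hN : (1 : ℝ) ≤ N := by exact_mod_cast NeZero.one_le
  have hsin : Real.sin (Real.pi / (2 * N)) ≠ 0 := by
    refine (Real.sin_pos_of_pos_of_lt_pi (by positivity) ?_).ne'
    rw [div_lt_iff₀ (by positivity)]
    nlinarith [Real.pi_pos]
  have h2 : Real.pi / N = 2 * (Real.pi / (2 * N)) := by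
    field_simp
  have h3 : √3 ^ 2 = (3 : ℝ) := Real.sq_sqrt (by norm_num)
  rw [h2, Real.sin_two_mul, tubeFlux, Real.cot_eq_cos_div_sin, tubeRadius, div_pow, h3]
  field_simp
  ring

lemma sin_edgeAngle_succ (N : ℕ) [NeZero N] (n : ℤ) (k : ZMod N) :
    Real.sin (edgeAngle N n (k + 1) - edgeAngle N (n + 1) k) = Real.sin (Real.pi / N) := by
  have hN : (N : ℝ) ≠ 0 := by exact_mod_cast NeZero.ne N
  -- Passing from `k` to `k + 1` may wrap around in `ℤ/N`; this changes the angle by a multiple of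
  -- `2π`.
  have hval : ∃ m : ℤ, ((k + 1).val : ℝ) = k.val + 1 + m * N := by
    have h : (((k + 1).val : ℤ) : ZMod N) = ((k.val + 1 : ℤ) : ZMod N) := by simp
    rw [ZMod.intCast_eq_intCast_iff] at h
    obtain ⟨m, hm⟩ := h.symm.dvd
    refine ⟨m, ?_⟩
    have : ((k + 1).val : ℤ) = k.val + 1 + m * N := by linear_combination hm
    exact_mod_cast this
  obtain ⟨m, hm⟩ := hval
  have : edgeAngle N n (k + 1) - edgeAngle N (n + 1) k = Real.pi / N + m * (2 * Real.pi) := by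
    rw [edgeAngle, edgeAngle, hm]
    push_cast
    field_simp
    ring
  rw [this, Real.sin_add_int_mul_two_pi]

lemma edgePotential_values (N : ℕ) [NeZero N] (B : ℝ) (n : ℤ) (k : ZMod N) (t : ℝ) :
    edgePotential N B (n, 0, k) t = 0 ∧ edgePotential N B (n, 1, k) t = tubeFlux N B ∧
      edgePotential N B (n, 2, k) t = tubeFlux N B := by
  have h2 : (2 : ZMod 3) ≠ 0 := by decide
  have h21 : (2 : ZMod 3) ≠ 1 := by decide
  refine ⟨?_, ?_, ?_⟩
  · rw [edgePotential_eq]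
    simp only [edgeStart, edgeEnd, if_true, lowerVertex, upperVertex, tubePoint_cross]
    simp
  · rw [edgePotential_eq]
    simp only [edgeStart, edgeEnd, one_ne_zero, if_true, if_false, lowerVertex, upperVertex,
      tubePoint_cross]
    rw [← tubeFlux_eq]
    congr 3
    simp only [edgeAngle]
    push_cast
    ring
  · rw [edgePotential_eq]
    simp only [edgeStart, edgeEnd, h2, h21, if_false, lowerVertex, upperVertex,
      tubePoint_cross]
    rw [← tubeFlux_eq, sin_edgeAngle_succ]

/-! ### Unitary maps between direct sums of Hilbert spaces -/

section Unitary

variable {E : Type} [NormedAddCommGroup E]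

lemma memℓp_two_iff {ι : Type} {f : ι → E} : Memℓp f 2 ↔ Summable fun i => ‖f i‖ ^ 2 := by
  rw [memℓp_gen_iff (by norm_num)]
  simp

lemma hasSum_norm_sq {ι : Type} (x : lp (fun _ : ι => E) 2) :
    HasSum (fun i => ‖x i‖ ^ 2) (‖x‖ ^ 2) := by
  simpa using lp.hasSum_norm (by norm_num) x

/-- The family is a finite sum over `κ` of its slices extended by zero. -/
lemma hasSum_prod_of_fintype {ι K : Type} [Fintype K] {f : ι × K → ℝ} {a : K → ℝ}
    (h : ∀ κ, HasSum (fun i => f (i, κ)) (a κ)) : HasSum f (∑ κ, a κ) := by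
  classical
  have h1 (κ : K) : HasSum (fun p : ι × K => if p.2 = κ then f p else 0) (a κ) := by
    have hinj : Function.Injective fun i : ι => (i, κ) := fun i j h => congrArg Prod.fst h
    rw [← hinj.hasSum_iff]
    · simpa [Function.comp_def] using h κ
    · rintro ⟨i, κ'⟩ hp
      refine if_neg ?_
      rintro rfl
      exact hp ⟨i, rfl⟩
  convert hasSum_sum fun κ (_ : κ ∈ Finset.univ) => h1 κ using 2 with p
  simp

/-- The restriction of an element of the Hilbert sum over `J ≃ ι × K` to the slice `ι × {κ}`. -/
def lpSlice {J ι K : Type} (e : J ≃ ι × K) (x : lp (fun _ : J => E) 2) (κ : K) :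
    lp (fun _ : ι => E) 2 :=
  ⟨fun i => x (e.symm (i, κ)), memℓp_two_iff.2 ((memℓp_two_iff.1 x.2).comp_injective
    (i := fun i => e.symm (i, κ)) (e.symm.injective.comp fun _ _ h => congrArg Prod.fst h))⟩

lemma sum_norm_lpSlice_sq {J ι K : Type} [Fintype K] (e : J ≃ ι × K) (x : lp (fun _ : J => E) 2) :
    ∑ κ, ‖lpSlice e x κ‖ ^ 2 = ‖x‖ ^ 2 :=
  (hasSum_prod_of_fintype (f := fun p => ‖x (e.symm p)‖ ^ 2)
    fun κ => hasSum_norm_sq (lpSlice e x κ)).unique (e.symm.hasSum_iff.2 (hasSum_norm_sq x))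

variable [InnerProductSpace ℂ E]

/-- Unitary maps of the summands give a unitary map of the Hilbert sum. -/
def lpCongrRight {ι : Type} (W : ι → E ≃ₗᵢ[ℂ] E) :
    lp (fun _ : ι => E) 2 ≃ₗᵢ[ℂ] lp (fun _ : ι => E) 2 where
  toFun x := ⟨fun i => W i (x i), memℓp_two_iff.2 (by simpa using memℓp_two_iff.1 x.2)⟩
  invFun x := ⟨fun i => (W i).symm (x i), memℓp_two_iff.2 (by simpa using memℓp_two_iff.1 x.2)⟩
  map_add' x y := by
    ext i
    exact (W i).map_add _ _
  map_smul' c x := by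
    ext i
    exact (W i).map_smul c _
  left_inv x := by
    ext i
    simp
  right_inv x := by
    ext i
    simp
  norm_map' x := by
    rw [← sq_eq_sq₀ (norm_nonneg _) (norm_nonneg _)]
    refine (hasSum_norm_sq _).unique ?_
    convert hasSum_norm_sq x using 2 with i
    simp

/-- The element of the Hilbert sum over `J ≃ ι × K` with given slices. -/
def lpGlue {J ι K : Type} [Fintype K] (e : J ≃ ι × K) (y : K → lp (fun _ : ι => E) 2) :
    lp (fun _ : J => E) 2 :=
  ⟨fun j => y (e j).2 (e j).1, memℓp_two_iff.2 (e.summable_iff.2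
    (hasSum_prod_of_fintype (f := fun p : ι × K => ‖y p.2 p.1‖ ^ 2)
      fun κ => hasSum_norm_sq (y κ)).summable)⟩

/-- The Hilbert sum over `ι × K`, `K` finite, as the sum over `K` of Hilbert sums over `ι`. -/
def lpCurry {J ι K : Type} [Fintype K] (e : J ≃ ι × K) :
    lp (fun _ : J => E) 2 ≃ₗᵢ[ℂ] PiLp 2 (fun _ : K => lp (fun _ : ι => E) 2) where
  toFun x := WithLp.toLp 2 (lpSlice e x)
  invFun y := lpGlue e y.ofLp
  map_add' _ _ := rfl
  map_smul' _ _ := rfl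
  left_inv x := by
    ext j : 2
    exact congrArg x (e.symm_apply_apply j)
  right_inv y := by
    ext κ i : 3
    change y (e (e.symm (i, κ))).2 (e (e.symm (i, κ))).1 = y κ i
    rw [e.apply_symm_apply]
  norm_map' x := by
    rw [← sq_eq_sq₀ (norm_nonneg _) (norm_nonneg _)]
    exact (PiLp.norm_sq_eq_of_L2 _ _).trans (sum_norm_lpSlice_sq e x)

variable {κ K : Type} [Fintype κ] [Fintype K] [DecidableEq K]

/-- Parseval's identity with coefficients in a Hilbert space: expand the squares and use that the
columns of `u` are orthonormal. -/
lemma sum_norm_sum_smul_sq (u : κ → K → ℂ)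
    (hcol : ∀ a b, ∑ k, starRingEnd ℂ (u k a) * u k b = if a = b then 1 else 0) (x : K → E) :
    ∑ k, ‖∑ a, u k a • x a‖ ^ 2 = ∑ a, ‖x a‖ ^ 2 := by
  rw [← ofReal_inj]
  push_cast
  have h (z : E) : (‖z‖ : ℂ) ^ 2 = inner ℂ z z := (inner_self_eq_norm_sq_to_K (𝕜 := ℂ) z).symm
  simp only [h, sum_inner, inner_sum, inner_smul_left, inner_smul_right]
  rw [Finset.sum_comm]
  refine Finset.sum_congr rfl fun a _ => ?_
  simp only [Finset.mul_sum]
  rw [Finset.sum_comm]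
  have (b : K) : ∑ k, u k a * (starRingEnd ℂ (u k b) * inner ℂ (x b) (x a)) =
      (if b = a then 1 else 0) * inner ℂ (x b) (x a) := by
    rw [← hcol, Finset.sum_mul]
    exact Finset.sum_congr rfl fun k _ => by ring
  simp [this]

variable [DecidableEq κ]

/-- The unitary map of finite sums of copies of `E` given by a unitary matrix. -/
def unitaryMix (u : κ → K → ℂ)
    (hcol : ∀ a b, ∑ k, starRingEnd ℂ (u k a) * u k b = if a = b then 1 else 0)
    (hrow : ∀ k l, ∑ a, u k a * starRingEnd ℂ (u l a) = if k = l then 1 else 0) :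
    PiLp 2 (fun _ : K => E) ≃ₗᵢ[ℂ] PiLp 2 (fun _ : κ => E) where
  toFun x := WithLp.toLp 2 fun k => ∑ a, u k a • x a
  invFun y := WithLp.toLp 2 fun a => ∑ k, starRingEnd ℂ (u k a) • y k
  map_add' x y := by
    ext k
    simp [smul_add, Finset.sum_add_distrib]
  map_smul' c x := by
    ext k
    simp [Finset.smul_sum, smul_comm c]
  left_inv x := by
    ext a
    simp only [Finset.smul_sum, smul_smul]
    rw [Finset.sum_comm]
    simp only [← Finset.sum_smul, hcol]
    simp
  right_inv y := by
    ext k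
    simp only [Finset.smul_sum, smul_smul]
    rw [Finset.sum_comm]
    simp only [← Finset.sum_smul, hrow]
    simp
  norm_map' x := by
    rw [← sq_eq_sq₀ (norm_nonneg _) (norm_nonneg _), PiLp.norm_sq_eq_of_L2 _ x]
    exact (PiLp.norm_sq_eq_of_L2 _ _).trans (sum_norm_sum_smul_sq u hcol x.ofLp)

end Unitary

/-! ### Gauge transformations -/

lemma norm_phase_mul (a t : ℝ) (z : ℂ) : ‖exp (I * (a * t)) * z‖ = ‖z‖ := by
  rw [norm_mul, mul_comm I, ← ofReal_mul, norm_exp_ofReal_mul_I, one_mul]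

lemma memLp_phase_mul (a : ℝ) (f : Lp ℂ 2 unitMeasure) :
    MemLp (fun t : ℝ => exp (I * (a * t)) * f t) 2 unitMeasure :=
  (Lp.memLp f).congr_norm (((Continuous.aestronglyMeasurable (by fun_prop)).mul
    (Lp.aestronglyMeasurable f)))
    (Filter.Eventually.of_forall fun t => (norm_phase_mul a t _).symm)

lemma toLp_phase_mul_toLp {a b : ℝ} (hab : a + b = 0) (f : Lp ℂ 2 unitMeasure) :
    (memLp_phase_mul b ((memLp_phase_mul a f).toLp)).toLp = f := by
  refine Lp.ext ?_
  filter_upwards [(memLp_phase_mul b ((memLp_phase_mul a f).toLp)).coeFn_toLp,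
    (memLp_phase_mul a f).coeFn_toLp] with t h1 h2
  rw [h1, h2, ← mul_assoc, ← exp_add, ← mul_add, ← add_mul, add_comm (b : ℂ), ← ofReal_add, hab]
  simp

/-- Multiplication of functions on `[0,1]` by `exp(iat)`. -/
def phaseMul (a : ℝ) : Lp ℂ 2 unitMeasure ≃ₗᵢ[ℂ] Lp ℂ 2 unitMeasure where
  toFun f := (memLp_phase_mul a f).toLp
  invFun f := (memLp_phase_mul (-a) f).toLp
  map_add' f g := by
    refine Lp.ext ?_
    filter_upwards [(memLp_phase_mul a (f + g)).coeFn_toLp, (memLp_phase_mul a f).coeFn_toLp,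
      (memLp_phase_mul a g).coeFn_toLp, Lp.coeFn_add f g,
      Lp.coeFn_add (memLp_phase_mul a f).toLp (memLp_phase_mul a g).toLp] with t h1 h2 h3 h4 h5
    simp only [h1, h4, h5, Pi.add_apply, h2, h3, mul_add]
  map_smul' c f := by
    refine Lp.ext ?_
    filter_upwards [(memLp_phase_mul a (c • f)).coeFn_toLp, (memLp_phase_mul a f).coeFn_toLp,
      Lp.coeFn_smul c f, Lp.coeFn_smul c (memLp_phase_mul a f).toLp] with t h1 h2 h3 h4
    simp only [h1, h4, Pi.smul_apply, h2, h3, smul_eq_mul, RingHom.id_apply]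
    ring
  left_inv := toLp_phase_mul_toLp (by ring)
  right_inv := toLp_phase_mul_toLp (by ring)
  norm_map' f := by
    refine (Lp.norm_toLp _ (memLp_phase_mul a f)).trans ?_
    rw [Lp.norm_def, eLpNorm_congr_norm_ae
      (Filter.Eventually.of_forall fun t => norm_phase_mul a t _)]

lemma coeFn_phaseMul (a : ℝ) (f : Lp ℂ 2 unitMeasure) :
    phaseMul a f =ᵐ[unitMeasure] fun t => exp (I * (a * t)) * f t :=
  (memLp_phase_mul a f).coeFn_toLp

lemma coeFn_phaseMul_symm (a : ℝ) (f : Lp ℂ 2 unitMeasure) :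
    (phaseMul a).symm f =ᵐ[unitMeasure] fun t => exp (I * ((-a : ℝ) * t)) * f t :=
  (memLp_phase_mul (-a) f).coeFn_toLp

lemma hasACDeriv_phase (a : ℝ) :
    HasACDeriv (fun t => exp (I * (a * t))) (fun t => I * a * exp (I * (a * t))) := by
  have hc : Continuous fun t : ℝ => I * a * exp (I * (a * t)) := by fun_prop
  refine ⟨hc.intervalIntegrable _ _, fun t _ => ?_⟩
  rw [intervalIntegral.integral_eq_sub_of_hasDerivAt (f := fun t : ℝ => exp (I * (a * t)))
    (fun x _ => ?_) (hc.intervalIntegrable _ _)]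
  · ring
  · have h := (((hasDerivAt_id (x : ℂ)).const_mul (a : ℂ)).const_mul I).cexp.comp_ofReal
    simpa [mul_comm, mul_assoc, mul_left_comm] using h

/-- Gauge covariance: the derivative of the phase is exactly absorbed by the change of the
potential. Taking `a = -α` for constant `α` removes the potential. -/
lemma HasMagDeriv.phase_mul {α : ℝ → ℝ} {f g : ℝ → ℂ} (h : HasMagDeriv α f g) (a : ℝ) :
    HasMagDeriv (fun t => α t + a) (fun t => exp (I * (a * t)) * f t)
      (fun t => exp (I * (a * t)) * g t) := by
  have h1 := (hasACDeriv_phase a).mul h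
  unfold HasMagDeriv
  convert h1 using 2
  push_cast
  ring

/-! ### The discrete Fourier transform around the tube -/

section Fourier

variable (N : ℕ) [NeZero N]

/-- The numbers `1, …, N` as a system of representatives of `ℤ/N`. -/
def finEquivZMod : Fin N ≃ ZMod N :=
  Equiv.ofBijective (fun k => ((k.val + 1 : ℤ) : ZMod N)) <| by
    rw [Fintype.bijective_iff_injective_and_card]
    refine ⟨fun k l h => ?_, by simp⟩
    have h1 : ((k.val : ℕ) : ZMod N) = ((l.val : ℕ) : ZMod N) := by simpa using h
    rw [ZMod.natCast_eq_natCast_iff', Nat.mod_eq_of_lt k.2, Nat.mod_eq_of_lt l.2] at h1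
    exact Fin.ext h1

/-- The coefficients `s^{(k+1)κ} / √N` of the discrete Fourier transform. -/
def dftCoeff (k : Fin N) (κ : ZMod N) : ℂ :=
  ((√N)⁻¹ : ℝ) * ZMod.stdAddChar (finEquivZMod N k * κ)

lemma stdAddChar_finEquivZMod (k : Fin N) :
    ZMod.stdAddChar (finEquivZMod N k) = sPow N (k.val + 1) := by
  rw [finEquivZMod, Equiv.ofBijective_apply, ZMod.stdAddChar_coe, sPow]
  congr 1
  ring

lemma sum_stdAddChar_mul (x : ZMod N) :
    ∑ y : ZMod N, ZMod.stdAddChar (y * x) = if x = 0 then (N : ℂ) else 0 := by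
  have := AddChar.sum_mulShift x (ZMod.isPrimitive_stdAddChar N)
  rw [this]
  split_ifs <;> simp

lemma inv_sqrt_mul_inv_sqrt_mul : (((√N)⁻¹ : ℝ) : ℂ) * ((√N)⁻¹ : ℝ) * N = 1 := by
  have hN : (0 : ℝ) < N := by exact_mod_cast NeZero.pos N
  have h : (√N)⁻¹ * (√N)⁻¹ * (N : ℝ) = 1 := by
    rw [← mul_inv, Real.mul_self_sqrt hN.le, inv_mul_cancel₀ hN.ne']
  exact_mod_cast h

lemma conj_dftCoeff (k : Fin N) (κ : ZMod N) : starRingEnd ℂ (dftCoeff N k κ) =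
    ((√N)⁻¹ : ℝ) * ZMod.stdAddChar (-(finEquivZMod N k * κ)) := by
  rw [dftCoeff, map_mul, conj_ofReal, AddChar.map_neg_eq_conj]

lemma dftCoeff_col (a b : ZMod N) :
    ∑ k, starRingEnd ℂ (dftCoeff N k a) * dftCoeff N k b = if a = b then 1 else 0 := by
  have h (k : Fin N) : starRingEnd ℂ (dftCoeff N k a) * dftCoeff N k b =
      ((√N)⁻¹ : ℝ) * ((√N)⁻¹ : ℝ) * ZMod.stdAddChar (finEquivZMod N k * (b - a)) := by
    rw [conj_dftCoeff, dftCoeff, mul_mul_mul_comm, ← AddChar.map_add_eq_mul]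
    congr 2
    ring
  simp only [h, ← Finset.mul_sum]
  rw [(finEquivZMod N).sum_comp fun y => ZMod.stdAddChar (y * (b - a)), sum_stdAddChar_mul,
    mul_ite, inv_sqrt_mul_inv_sqrt_mul, mul_zero]
  simp only [sub_eq_zero, eq_comm]

lemma dftCoeff_row (k l : Fin N) :
    ∑ a, dftCoeff N k a * starRingEnd ℂ (dftCoeff N l a) = if k = l then 1 else 0 := by
  have h (a : ZMod N) : dftCoeff N k a * starRingEnd ℂ (dftCoeff N l a) =
      ((√N)⁻¹ : ℝ) * ((√N)⁻¹ : ℝ) *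
        ZMod.stdAddChar (a * (finEquivZMod N k - finEquivZMod N l)) := by
    rw [conj_dftCoeff, dftCoeff, mul_mul_mul_comm, ← AddChar.map_add_eq_mul]
    congr 2
    ring
  simp only [h, ← Finset.mul_sum]
  rw [sum_stdAddChar_mul, mul_ite, inv_sqrt_mul_inv_sqrt_mul, mul_zero]
  simp only [sub_eq_zero, (finEquivZMod N).injective.eq_iff]

lemma dftCoeff_add_one (k : Fin N) (κ : ZMod N) :
    dftCoeff N k (κ + 1) = sPow N (k.val + 1) * dftCoeff N k κ := by
  rw [dftCoeff, dftCoeff, mul_add, mul_one, AddChar.map_add_eq_mul, stdAddChar_finEquivZMod]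
  ring

/-- The Fourier transform diagonalises the shift around the tube; this is the origin of `s^k` in the
twisted conditions, the index `k.val + 1` running through `1, …, N`. -/
lemma sum_dftCoeff_mul_sub_one (k : Fin N) (h : ZMod N → ℂ) :
    ∑ κ, dftCoeff N k κ * h (κ - 1) = sPow N (k.val + 1) * ∑ κ, dftCoeff N k κ * h κ := by
  rw [← Equiv.sum_comp (Equiv.addRight (1 : ZMod N)), Finset.mul_sum]
  refine Finset.sum_congr rfl fun κ _ => ?_
  rw [Equiv.coe_addRight, dftCoeff_add_one, add_sub_cancel_right, mul_assoc]

lemma conj_dftCoeff_sub_one (k : Fin N) (κ : ZMod N) :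
    starRingEnd ℂ (dftCoeff N k (κ - 1)) =
      sPow N (k.val + 1) * starRingEnd ℂ (dftCoeff N k κ) := by
  rw [conj_dftCoeff, conj_dftCoeff, mul_sub, neg_sub, sub_eq_add_neg, AddChar.map_add_eq_mul,
    mul_one, stdAddChar_finEquivZMod]
  ring

end Fourier

/-! ### The unitary equivalence -/

/-- The gauge parameter of the edges of type `j`: the value of the tangential potential. -/
def gaugeCoeff (a : ℝ) (j : ZMod 3) : ℝ := if j = 0 then 0 else a

lemma edgePotential_eq_gaugeCoeff (N : ℕ) [NeZero N] (B : ℝ) (ω : Edge N) (t : ℝ) :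
    edgePotential N B ω t = gaugeCoeff (tubeFlux N B) ω.2.1 := by
  obtain ⟨n, j, k⟩ := ω
  obtain ⟨h0, h1, h2⟩ := edgePotential_values N B n k t
  fin_cases j
  · exact h0
  · exact h1
  · exact h2

section TubeUnitary

variable (N : ℕ) [NeZero N] (a : ℝ)

/-- The gauge transformation followed by the discrete Fourier transform around the tube. -/
def tubeUnitary : GraphL2 (Edge N) ≃ₗᵢ[ℂ] PiLp 2 (fun _ : Fin N => GraphL2 Edge₁) :=
  (lpCongrRight fun ω : Edge N => phaseMul (-gaugeCoeff a ω.2.1)).trans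
    ((lpCurry (Equiv.prodAssoc ℤ (ZMod 3) (ZMod N)).symm).trans
      (unitaryMix (dftCoeff N) (dftCoeff_col N) (dftCoeff_row N)))

lemma tubeUnitary_apply (x : GraphL2 (Edge N)) (k : Fin N) (ω : Edge₁) :
    tubeUnitary N a x k ω = ∑ κ, dftCoeff N k κ •
      phaseMul (-gaugeCoeff a ω.2) (x (ω.1, ω.2, κ)) := by
  change (∑ κ, dftCoeff N k κ • lpSlice _ _ κ : GraphL2 Edge₁) ω = _
  rw [lp.coeFn_sum, Finset.sum_apply]
  rfl

lemma tubeUnitary_symm_apply (y : PiLp 2 (fun _ : Fin N => GraphL2 Edge₁)) (ω : Edge N) :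
    (tubeUnitary N a).symm y ω = (phaseMul (-gaugeCoeff a ω.2.1)).symm
      (∑ k, starRingEnd ℂ (dftCoeff N k ω.2.2) • y k (ω.1, ω.2.1)) := by
  change (phaseMul (-gaugeCoeff a ω.2.1)).symm
    ((∑ k, starRingEnd ℂ (dftCoeff N k ω.2.2) • y k : GraphL2 Edge₁) (ω.1, ω.2.1)) = _
  rw [lp.coeFn_sum, Finset.sum_apply]
  rfl

/-- The action of `tubeUnitary` on families of functions. -/
def tubeTransform (k : Fin N) (f : Edge N → ℝ → ℂ) (ω : Edge₁) (t : ℝ) : ℂ :=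
  exp (I * ((-gaugeCoeff a ω.2 : ℝ) * t)) * ∑ κ, dftCoeff N k κ * f (ω.1, ω.2, κ) t

/-- The action of the inverse of `tubeUnitary` on families of functions. -/
def tubeInverseTransform (g : Fin N → Edge₁ → ℝ → ℂ) (ω : Edge N) (t : ℝ) : ℂ :=
  exp (I * (gaugeCoeff a ω.2.1 * t)) *
    ∑ k, starRingEnd ℂ (dftCoeff N k ω.2.2) * g k (ω.1, ω.2.1) t

lemma coeFn_sum_smul {ι : Type} [Fintype ι] (c : ι → ℂ) (x : ι → Lp ℂ 2 unitMeasure)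
    {f : ι → ℝ → ℂ} (h : ∀ i, x i =ᵐ[unitMeasure] f i) :
    (∑ i, c i • x i : Lp ℂ 2 unitMeasure) =ᵐ[unitMeasure] fun t => ∑ i, c i * f i t := by
  have h1 (i : ι) := Lp.coeFn_smul (c i) (x i)
  filter_upwards [Lp.coeFn_fun_finsetSum Finset.univ fun i => c i • x i, ae_all_iff.2 h1,
    ae_all_iff.2 h] with t h2 h3 h4
  rw [h2]
  refine Finset.sum_congr rfl fun i _ => ?_
  rw [h3 i, Pi.smul_apply, h4 i, smul_eq_mul]

lemma coeFn_tubeUnitary {x : GraphL2 (Edge N)} {f : Edge N → ℝ → ℂ}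
    (h : ∀ ω, x ω =ᵐ[unitMeasure] f ω) (k : Fin N) (ω : Edge₁) :
    tubeUnitary N a x k ω =ᵐ[unitMeasure] tubeTransform N a k f ω := by
  rw [tubeUnitary_apply]
  simp only [← map_smul, ← map_sum]
  filter_upwards [coeFn_phaseMul (-gaugeCoeff a ω.2)
    (∑ κ, dftCoeff N k κ • x (ω.1, ω.2, κ)), coeFn_sum_smul (dftCoeff N k)
    (fun κ => x (ω.1, ω.2, κ)) fun κ => h (ω.1, ω.2, κ)] with t h1 h2
  rw [h1, h2]
  rfl

lemma coeFn_tubeUnitary_symm {y : PiLp 2 (fun _ : Fin N => GraphL2 Edge₁)}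
    {g : Fin N → Edge₁ → ℝ → ℂ} (h : ∀ k ω, y k ω =ᵐ[unitMeasure] g k ω) (ω : Edge N) :
    (tubeUnitary N a).symm y ω =ᵐ[unitMeasure] tubeInverseTransform N a g ω := by
  rw [tubeUnitary_symm_apply]
  filter_upwards [coeFn_phaseMul_symm (-gaugeCoeff a ω.2.1)
    (∑ k, starRingEnd ℂ (dftCoeff N k ω.2.2) • y k (ω.1, ω.2.1)),
    coeFn_sum_smul (fun k => starRingEnd ℂ (dftCoeff N k ω.2.2))
    (fun k => y k (ω.1, ω.2.1)) fun k => h k (ω.1, ω.2.1)] with t h1 h2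
  rw [h1, h2, neg_neg]
  rfl

lemma hasMagDeriv_sum {ι : Type} [Fintype ι] {α : ℝ → ℝ} {f g : ι → ℝ → ℂ} (c : ι → ℂ)
    (h : ∀ i, HasMagDeriv α (f i) (g i)) :
    HasMagDeriv α (fun t => ∑ i, c i * f i t) (fun t => ∑ i, c i * g i t) := by
  classical
  induction (Finset.univ : Finset ι) using Finset.induction_on with
  | empty => simp [HasMagDeriv, HasACDeriv]
  | insert i s hi ih =>
    simp only [Finset.sum_insert hi]
    exact ((h i).smul (c i)).add ih

variable {N a}

lemma hasMagDeriv_tubeTransform {f g : Edge N → ℝ → ℂ}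
    (h : ∀ ω, HasMagDeriv (fun _ => gaugeCoeff a ω.2.1) (f ω) (g ω)) (k : Fin N) (ω : Edge₁) :
    HasMagDeriv (fun _ => 0) (tubeTransform N a k f ω) (tubeTransform N a k g ω) := by
  have h1 := (hasMagDeriv_sum (α := fun _ => gaugeCoeff a ω.2) (f := fun κ => f (ω.1, ω.2, κ))
    (g := fun κ => g (ω.1, ω.2, κ)) (dftCoeff N k) fun κ => h (ω.1, ω.2, κ)).phase_mul (-gaugeCoeff a ω.2)
  simp only [add_neg_cancel] at h1
  exact h1

lemma hasMagDeriv_tubeInverseTransform {f g : Fin N → Edge₁ → ℝ → ℂ}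
    (h : ∀ k ω, HasMagDeriv (fun _ => 0) (f k ω) (g k ω)) (ω : Edge N) :
    HasMagDeriv (fun _ => gaugeCoeff a ω.2.1) (tubeInverseTransform N a f ω)
      (tubeInverseTransform N a g ω) := by
  have h1 := (hasMagDeriv_sum (f := fun k => f k (ω.1, ω.2.1)) (g := fun k => g k (ω.1, ω.2.1))
    (fun k => starRingEnd ℂ (dftCoeff N k ω.2.2)) fun k => h k (ω.1, ω.2.1)).phase_mul (gaugeCoeff a ω.2.1)
  simp only [zero_add] at h1
  exact h1

/-- The transform acts linearly at each fixed `t`. It is applied with `c = q t`, which is the same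
on all edges and so may be taken out. -/
lemma tubeTransform_neg_add_mul (k : Fin N) (f f₂ : Edge N → ℝ → ℂ) (c : ℂ) (ω : Edge₁) (t : ℝ) :
    tubeTransform N a k (fun ω t => -f₂ ω t + c * f ω t) ω t =
      -tubeTransform N a k f₂ ω t + c * tubeTransform N a k f ω t := by
  have : ∑ κ, dftCoeff N k κ * (-f₂ (ω.1, ω.2, κ) t + c * f (ω.1, ω.2, κ) t) =
      -∑ κ, dftCoeff N k κ * f₂ (ω.1, ω.2, κ) t + c * ∑ κ, dftCoeff N k κ * f (ω.1, ω.2, κ) t := by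
    rw [← Finset.sum_neg_distrib, Finset.mul_sum, ← Finset.sum_add_distrib]
    exact Finset.sum_congr rfl fun κ _ => by ring
  rw [tubeTransform, this, tubeTransform, tubeTransform]
  ring

lemma tubeInverseTransform_neg_add_mul (f f₂ : Fin N → Edge₁ → ℝ → ℂ) (c : ℂ) (ω : Edge N)
    (t : ℝ) :
    tubeInverseTransform N a (fun k ω t => -f₂ k ω t + c * f k ω t) ω t =
      -tubeInverseTransform N a f₂ ω t + c * tubeInverseTransform N a f ω t := by
  have : ∑ k, starRingEnd ℂ (dftCoeff N k ω.2.2) *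
        (-f₂ k (ω.1, ω.2.1) t + c * f k (ω.1, ω.2.1) t) =
      -∑ k, starRingEnd ℂ (dftCoeff N k ω.2.2) * f₂ k (ω.1, ω.2.1) t +
        c * ∑ k, starRingEnd ℂ (dftCoeff N k ω.2.2) * f k (ω.1, ω.2.1) t := by
    rw [← Finset.sum_neg_distrib, Finset.mul_sum, ← Finset.sum_add_distrib]
    exact Finset.sum_congr rfl fun κ _ => by ring
  rw [tubeInverseTransform, this, tubeInverseTransform, tubeInverseTransform]
  ring

/-- The gauge factor on a slanted edge is `1` at `t = 0` and `exp(-ia)` at `t = 1`, where it cancels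
the `exp(ia)` of the twisted conditions. The neighbour `κ - 1` contributes `s^k`. -/
lemma endpoints_tubeTransform_mem {f f₁ : Edge N → ℝ → ℂ}
    (h : (endpoints f, endpoints f₁) ∈ kirchhoff N) (k : Fin N) :
    (endpoints (tubeTransform N a k f), endpoints (tubeTransform N a k f₁)) ∈
      twistedKirchhoff N a (k.val + 1) := by
  intro n
  have h' (κ : ZMod N) := h n κ
  simp only [endpoints, Matrix.cons_val_zero, Matrix.cons_val_one] at h' ⊢
  have h2 : (2 : ZMod 3) ≠ 0 := by decide
  have hp : exp (I * a) * exp (-(I * a)) = 1 := by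
    rw [← exp_add, add_neg_cancel, exp_zero]
  have e1 : ∑ κ, dftCoeff N k κ * f (n, 0, κ) 1 = ∑ κ, dftCoeff N k κ * f (n, 1, κ) 0 :=
    Finset.sum_congr rfl fun κ _ => by rw [(h' κ).1.1]
  have e2 : ∑ κ, dftCoeff N k κ * f (n, 1, κ) 0 =
      sPow N (k.val + 1) * ∑ κ, dftCoeff N k κ * f (n, 2, κ) 1 := by
    rw [← sum_dftCoeff_mul_sub_one]
    exact Finset.sum_congr rfl fun κ _ => by rw [(h' κ).1.2]
  have e3 : ∑ κ, dftCoeff N k κ * f (n + 1, 0, κ) 0 = ∑ κ, dftCoeff N k κ * f (n, 1, κ) 1 :=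
    Finset.sum_congr rfl fun κ _ => by rw [(h' κ).2.1.1]
  have e4 : ∑ κ, dftCoeff N k κ * f (n, 1, κ) 1 = ∑ κ, dftCoeff N k κ * f (n, 2, κ) 0 :=
    Finset.sum_congr rfl fun κ _ => by rw [(h' κ).2.1.2]
  have e5 : -∑ κ, dftCoeff N k κ * f₁ (n, 0, κ) 1 + ∑ κ, dftCoeff N k κ * f₁ (n, 1, κ) 0 -
      sPow N (k.val + 1) * ∑ κ, dftCoeff N k κ * f₁ (n, 2, κ) 1 = 0 := by
    rw [← sum_dftCoeff_mul_sub_one N k fun κ => f₁ (n, 2, κ) 1, ← Finset.sum_neg_distrib,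
      ← Finset.sum_add_distrib, ← Finset.sum_sub_distrib]
    exact Finset.sum_eq_zero fun κ _ => by linear_combination dftCoeff N k κ * (h' κ).2.2.1
  have e6 : ∑ κ, dftCoeff N k κ * f₁ (n + 1, 0, κ) 0 - ∑ κ, dftCoeff N k κ * f₁ (n, 1, κ) 1 +
      ∑ κ, dftCoeff N k κ * f₁ (n, 2, κ) 0 = 0 := by
    rw [← Finset.sum_sub_distrib, ← Finset.sum_add_distrib]
    exact Finset.sum_eq_zero fun κ _ => by linear_combination dftCoeff N k κ * (h' κ).2.2.2
  simp only [tubeTransform, gaugeCoeff, if_true, one_ne_zero, h2, if_false, neg_zero, ofReal_zero,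
    mul_zero, exp_zero, one_mul, ofReal_one, mul_one, ofReal_neg, mul_neg]
  exact ⟨⟨e1, by linear_combination e2 - sPow N (k.val + 1) *
      (∑ κ, dftCoeff N k κ * f (n, 2, κ) 1) * hp⟩,
    ⟨by linear_combination e3 - (∑ κ, dftCoeff N k κ * f (n, 1, κ) 1) * hp,
      by linear_combination e4 + (∑ κ, dftCoeff N k κ * f (n, 1, κ) 1) * hp⟩,
    by linear_combination e5 - sPow N (k.val + 1) *
      (∑ κ, dftCoeff N k κ * f₁ (n, 2, κ) 1) * hp,
    by linear_combination e6 - (∑ κ, dftCoeff N k κ * f₁ (n, 1, κ) 1) * hp⟩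

/-- Each condition on the tube is a combination of the twisted conditions over all `k` with
conjugate coefficients, whose shift by one again produces `s^k`. -/
lemma endpoints_tubeInverseTransform_mem {g g₁ : Fin N → Edge₁ → ℝ → ℂ}
    (h : ∀ k, (endpoints (g k), endpoints (g₁ k)) ∈ twistedKirchhoff N a (k.val + 1)) :
    (endpoints (tubeInverseTransform N a g), endpoints (tubeInverseTransform N a g₁)) ∈
      kirchhoff N := by
  intro n κ
  have h' (k : Fin N) := h k n
  simp only [endpoints, Matrix.cons_val_zero, Matrix.cons_val_one] at h' ⊢
  have h2 : (2 : ZMod 3) ≠ 0 := by decide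
  simp only [tubeInverseTransform, gaugeCoeff, if_true, one_ne_zero, h2, if_false, ofReal_zero,
    mul_zero, exp_zero, one_mul, ofReal_one, mul_one, conj_dftCoeff_sub_one]
  simp only [Finset.mul_sum]
  refine ⟨⟨?_, ?_⟩, ⟨?_, ?_⟩, ?_, ?_⟩
  · exact Finset.sum_congr rfl fun k _ => by rw [(h' k).1.1]
  · exact Finset.sum_congr rfl fun k _ => by rw [(h' k).1.2]; ring
  · exact Finset.sum_congr rfl fun k _ => by rw [(h' k).2.1.1]; ring
  · exact Finset.sum_congr rfl fun k _ => by rw [← (h' k).2.1.2]; ring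
  · rw [← Finset.sum_neg_distrib, ← Finset.sum_add_distrib, ← Finset.sum_sub_distrib]
    exact Finset.sum_eq_zero fun k _ => by
      linear_combination starRingEnd ℂ (dftCoeff N k κ) * (h' k).2.2.1
  · rw [← Finset.sum_sub_distrib, ← Finset.sum_add_distrib]
    exact Finset.sum_eq_zero fun k _ => by
      linear_combination starRingEnd ℂ (dftCoeff N k κ) * (h' k).2.2.2

lemma mem_schrodingerGraph_iff {ι : Type} (α : ι → ℝ → ℝ) (q : ℝ → ℝ)
    (BC : Submodule ℂ (BoundaryData ι)) (x y : GraphL2 ι) :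
    (x, y) ∈ schrodingerGraph α q BC ↔ ∃ f f₁ f₂ : ι → ℝ → ℂ,
      (∀ ω, x ω =ᵐ[unitMeasure] f ω) ∧
      (∀ ω, HasMagDeriv (α ω) (f ω) (f₁ ω)) ∧
      (∀ ω, HasMagDeriv (α ω) (f₁ ω) (f₂ ω)) ∧
      (∃ G : GraphL2 ι, ∀ ω, G ω =ᵐ[unitMeasure] f₂ ω) ∧
      (endpoints f, endpoints f₁) ∈ BC ∧
      ∀ ω, y ω =ᵐ[unitMeasure] fun t => -f₂ ω t + (q t : ℂ) * f ω t :=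
  Iff.rfl

/-- The witnesses `f`, `∂f`, `∂²f` are all carried by the same transform: forwards by
`tubeTransform`, backwards by `tubeInverseTransform`. -/
lemma mem_schrodingerGraph_iff_tubeUnitary (q : ℝ → ℝ) (x y : GraphL2 (Edge N)) :
    (x, y) ∈ schrodingerGraph (fun ω : Edge N => fun _ => gaugeCoeff a ω.2.1) q (kirchhoff N) ↔
      ∀ k : Fin N, (tubeUnitary N a x k, tubeUnitary N a y k) ∈
        schrodingerGraph (fun _ _ => 0) q (twistedKirchhoff N a (k.val + 1)) := by
  simp only [mem_schrodingerGraph_iff]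
  constructor
  · rintro ⟨f, f₁, f₂, hx, h₁, h₂, ⟨G, hG⟩, hbc, hy⟩ k
    refine ⟨tubeTransform N a k f, tubeTransform N a k f₁, tubeTransform N a k f₂,
      coeFn_tubeUnitary N a hx k, hasMagDeriv_tubeTransform h₁ k, hasMagDeriv_tubeTransform h₂ k,
      ⟨tubeUnitary N a G k, coeFn_tubeUnitary N a hG k⟩, endpoints_tubeTransform_mem hbc k,
      fun ω => ?_⟩
    filter_upwards [coeFn_tubeUnitary N a hy k ω] with t ht
    exact ht.trans (tubeTransform_neg_add_mul k f f₂ (q t) ω t)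
  · intro h
    choose g g₁ g₂ hx h₁ h₂ hG hbc hy using h
    choose G hG using hG
    refine ⟨tubeInverseTransform N a g, tubeInverseTransform N a g₁, tubeInverseTransform N a g₂,
      fun ω => ?_, hasMagDeriv_tubeInverseTransform h₁, hasMagDeriv_tubeInverseTransform h₂,
      ⟨(tubeUnitary N a).symm (WithLp.toLp 2 G), coeFn_tubeUnitary_symm N a hG⟩,
      endpoints_tubeInverseTransform_mem hbc, fun ω => ?_⟩
    · have h3 := coeFn_tubeUnitary_symm N a (y := tubeUnitary N a x) hx ω
      rw [LinearIsometryEquiv.symm_apply_apply] at h3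
      exact h3
    · have h3 := coeFn_tubeUnitary_symm N a (y := tubeUnitary N a y) hy ω
      rw [LinearIsometryEquiv.symm_apply_apply] at h3
      filter_upwards [h3] with t ht
      exact ht.trans (tubeInverseTransform_neg_add_mul g g₂ (q t) ω t)

end TubeUnitary

/-! ### Unbounded operators compared through their graphs -/

lemma mem_graph_orthogonalSum {κ E : Type} [Fintype κ] [NormedAddCommGroup E]
    [InnerProductSpace ℂ E] (T : κ → E →ₗ.[ℂ] E) (x y : PiLp 2 (fun _ : κ => E)) :
    (x, y) ∈ (orthogonalSum T).graph ↔ ∀ k, (x k, y k) ∈ (T k).graph := by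
  simp only [LinearPMap.mem_graph_iff]
  constructor
  · rintro ⟨z, rfl, rfl⟩ k
    exact ⟨⟨z.1 k, z.2 k⟩, rfl, rfl⟩
  · intro h
    choose z hz hTz using h
    refine ⟨⟨x, fun k => hz k ▸ (z k).2⟩, rfl, ?_⟩
    ext k
    refine Eq.trans ?_ (hTz k)
    exact congrArg (T k) (Subtype.ext (hz k).symm)

/-- The domain is the projection of the graph, so surjectivity of `U` matches the domains; the
intertwining relation holds because a graph is single-valued. -/
lemma unitarilyEquivalent_of_graph {E F : Type} [NormedAddCommGroup E] [InnerProductSpace ℂ E]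
    [NormedAddCommGroup F] [InnerProductSpace ℂ F] {S : E →ₗ.[ℂ] E} {T : F →ₗ.[ℂ] F}
    (U : E ≃ₗᵢ[ℂ] F) (h : ∀ x y, (x, y) ∈ S.graph ↔ (U x, U y) ∈ T.graph) :
    UnitarilyEquivalent S T := by
  refine ⟨U, fun x => ?_, fun x y hxy => ?_⟩
  · rw [LinearPMap.mem_domain_iff, LinearPMap.mem_domain_iff, U.surjective.exists]
    exact exists_congr (h x)
  · exact T.mem_graph_snd_inj ((h _ _).1 (S.mem_graph x)) (T.mem_graph y) hxy

theorem unitarilyEquivalent_magneticOp (N : ℕ) [NeZero N] (B : ℝ) (q : ℝ → ℝ) :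
    UnitarilyEquivalent (magneticOp N B q)
      (orthogonalSum fun k : Fin N => twistedOp N (tubeFlux N B) q (k.val + 1)) := by
  refine unitarilyEquivalent_of_graph (tubeUnitary N (tubeFlux N B)) fun x y => ?_
  have hA : edgePotential N B = fun ω _ => gaugeCoeff (tubeFlux N B) ω.2.1 := by
    funext ω t
    exact edgePotential_eq_gaugeCoeff N B ω t
  rw [mem_graph_orthogonalSum, magneticOp, schrodingerOp_graph, hA,
    mem_schrodingerGraph_iff_tubeUnitary]
  simp only [twistedOp, schrodingerOp_graph]

end ZigzagTube

end

open ZigzagTube in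
theorem theorem1p1 (N : ℕ) [NeZero N] (q : ℝ → ℝ)
    (hq : MeasureTheory.MemLp q 2 unitMeasure) :
    (∀ B : ℝ,
      (∀ (n : ℤ) (k : ZMod N) (t : ℝ), edgePotential N B (n, 0, k) t = 0 ∧
        edgePotential N B (n, 1, k) t = tubeFlux N B ∧
        edgePotential N B (n, 2, k) t = tubeFlux N B) ∧
      UnitarilyEquivalent (magneticOp N B q)
        (orthogonalSum fun k : Fin N => twistedOp N (tubeFlux N B) q (k.val + 1))) ∧
    (∀ (a : ℝ) (k : ℤ), cCoef N a k ≠ 0 →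
      ∃ Θ dΘ Φ dΦ : ℂ → Edge₁ → ℝ → ℂ,
        (∀ lam ∉ dirichletSpectrum q,
          IsUniqueGraphSolution N a q k lam 1 0 (Θ lam) (dΘ lam) ∧
          IsUniqueGraphSolution N a q k lam 0 1 (Φ lam) (dΦ lam)) ∧
        (∀ ω, ∀ t ∈ Set.Icc (0 : ℝ) 1,
          MeromorphicOn (fun lam => Θ lam ω t) Set.univ ∧
          MeromorphicOn (fun lam => Φ lam ω t) Set.univ ∧
          AnalyticOnNhd ℂ (fun lam => Θ lam ω t) (dirichletSpectrum q)ᶜ ∧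
          AnalyticOnNhd ℂ (fun lam => Φ lam ω t) (dirichletSpectrum q)ᶜ) ∧
        (∀ lam ∉ dirichletSpectrum q,
          graphMonodromy (Θ lam) (dΘ lam) (Φ lam) (dΦ lam) =
              (scalingMatrix q lam)⁻¹ * transferMatrix N a q k lam * scalingMatrix q lam *
                scalarMonodromy q lam ∧
          (graphMonodromy (Θ lam) (dΘ lam) (Φ lam) (dΦ lam)).det = sPow N (-k) ∧
          (graphMonodromy (Θ lam) (dΘ lam) (Φ lam) (dΦ lam)).trace =
            2 * sNegHalfPow N k * (lyapunovF q lam + (sCoef N a k : ℂ) ^ 2) / (cCoef N a k : ℂ)) ∧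
        ∃ D : ℂ × ℂ → ℂ, Differentiable ℂ D ∧
          ∀ τ : ℂ, ∀ lam ∉ dirichletSpectrum q,
            D (τ, lam) = (graphMonodromy (Θ lam) (dΘ lam) (Φ lam) (dΦ lam) -
              τ • (1 : Matrix (Fin 2) (Fin 2) ℂ)).det) := by
  refine ⟨fun B => ⟨fun n k t => edgePotential_values N B n k t,
    unitarilyEquivalent_magneticOp N B q⟩, fun a k hc => ?_⟩
  exact exists_fundamental_graph_solutions N (intervalIntegrable_potential hq) a k hc
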